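/- Let $k$ be a field, let $R$ be an associative unital $k$-algebra, and let $H$ be a finite-dimensional Hopf algebra over $k$ which is commutative or cocommutative and such that the characteristic of $k$ does not divide $\dim_k H$. Let $R\#_\sigma H$ be a crossed product, that is: there are given a linear action $H\otimes R\to R$, $h\otimes a\mapsto h\cdot a$, which measures $R$ (i.e. $h\cdot(ab)=\sum(h_1\cdot a)(h_2\cdot b)$ and $h\cdot 1=\varepsilon(h)1$) and a convolution-invertible linear map $\sigma:H\otimes H\to R$ such that $R\otimes H$ is an associative algebra with identity $1\#1$ under the multiplication $$(a\#h)(b\#g)=\sum a\,(h_1\cdot b)\,\sigma(h_2,g_1)\#h_3g_2 ,$$ where $a\#h$ denotes $a\otimes h$; this algebra is $R\#_\sigma H$. Let $rgD$, $lgD$, $wD$ denote the right global, left global and weak dimension. Then (i) $rgD(R)=rgD(R\#_\sigma H)$; (ii) $lgD(R)=lgD(R\#_\sigma H)$; (iii) $wD(R)=wD(R\#_\sigma H)$; (iv) $R$ is semisimple artinian if and only if $R\#_\sigma H$ is semisimple artinian; (v) $R$ is left (respectively right) hereditary if and only if $R\#_\sigma H$ is left (respectively right) hereditary, and $R$ is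 left (respectively right) semihereditary if and only if $R\#_\sigma H$ is left (respectively right) semihereditary; (vi) $R$ is von Neumann regular if and only if $R\#_\sigma H$ is von Neumann regular. Moreover, if $G$ is a finite group acting on $R$ by ring automorphisms and $|G|$ is invertible in $k$, then $rgD(R)=rgD(R*G)$, where $R*G$ is the skew group ring, i.e. the free left $R$-module with basis $G$ and multiplication $(ag)(bh)=a\,g(b)\,gh$. -/

import Mathlib

open scoped TensorProduct

universe u v w

section CrossedProducts

/-- The multiplication on `R ⊗ H` attached to maps `act : H → End R`, `h ↦ (h · -)`, and
`σ : H ⊗ H → R`; in Sweedler notation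
`(a # h) (b # g) = ∑ a (h₁ · b) σ (h₂, g₁) # h₃ g₂`
(see `crossedMul_tmul_tmul`). It is the composite
`(a ⊗ h) ⊗ (b ⊗ g) ↦ ∑ ((a ⊗ h₁) ⊗ h₂) ⊗ (b ⊗ g) ↦ ∑ ((a ⊗ h₁) ⊗ b) ⊗ (h₂ ⊗ g)`
`↦ ∑ a (h₁ · b) ⊗ (σ (h₂, g₁) ⊗ h₃ g₂) ↦ ∑ a (h₁ · b) σ (h₂, g₁) ⊗ h₃ g₂`. -/
noncomputable def crossedMul {k R H : Type*} [Field k] [Ring R] [Algebra k R] [Ring H]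
    [HopfAlgebra k H] (act : H →ₗ[k] R →ₗ[k] R) (σ : H ⊗[k] H →ₗ[k] R) :
    R ⊗[k] H →ₗ[k] R ⊗[k] H →ₗ[k] R ⊗[k] H :=
  TensorProduct.curry
    ((LinearMap.mul' k R).rTensor H
      ∘ₗ (TensorProduct.assoc k R R H).symm.toLinearMap
      ∘ₗ TensorProduct.map
          (LinearMap.mul' k R ∘ₗ (TensorProduct.lift act).lTensor R
            ∘ₗ (TensorProduct.assoc k R H R).toLinearMap)
          (TensorProduct.map σ (LinearMap.mul' k H)
            ∘ₗ (Coalgebra.comul : H ⊗[k] H →ₗ[k] (H ⊗[k] H) ⊗[k] (H ⊗[k] H)))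
      ∘ₗ (TensorProduct.tensorTensorTensorComm k (R ⊗[k] H) H R H).toLinearMap
      ∘ₗ ((TensorProduct.assoc k R H H).symm.toLinearMap
            ∘ₗ (Coalgebra.comul : H →ₗ[k] H ⊗[k] H).lTensor R).rTensor (R ⊗[k] H))

/-- The defining formula of the multiplication, for arbitrary presentations
`∑ h₁ ⊗ h₂ ⊗ h₃ = ∑ i ∈ s, x i ⊗ y i ⊗ z i` and `∑ g₁ ⊗ g₂ = ∑ j ∈ t, p j ⊗ q j`. -/
theorem crossedMul_tmul_tmul {k R H : Type*} [Field k] [Ring R] [Algebra k R] [Ring H]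
    [HopfAlgebra k H] (act : H →ₗ[k] R →ₗ[k] R) (σ : H ⊗[k] H →ₗ[k] R)
    (a b : R) (h g : H) {ι κ : Type*} (s : Finset ι) (t : Finset κ) (x y z : ι → H) (p q : κ → H)
    (hh : (Coalgebra.comul : H →ₗ[k] H ⊗[k] H).lTensor H (Coalgebra.comul h)
      = ∑ i ∈ s, x i ⊗ₜ[k] (y i ⊗ₜ[k] z i))
    (hg : (Coalgebra.comul g : H ⊗[k] H) = ∑ j ∈ t, p j ⊗ₜ[k] q j) :
    crossedMul act σ (a ⊗ₜ[k] h) (b ⊗ₜ[k] g)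
      = ∑ i ∈ s, ∑ j ∈ t, (a * act (x i) b * σ (y i ⊗ₜ[k] p j)) ⊗ₜ[k] (z i * q j) := by
  have key : crossedMul act σ (a ⊗ₜ[k] h) (b ⊗ₜ[k] g) =
      ((LinearMap.mul' k R).rTensor H ∘ₗ (TensorProduct.assoc k R R H).symm.toLinearMap
        ∘ₗ TensorProduct.map (LinearMap.mulLeft k a ∘ₗ act.flip b)
          (TensorProduct.map σ (LinearMap.mul' k H)
            ∘ₗ (TensorProduct.tensorTensorTensorComm k H H H H).toLinearMap
            ∘ₗ (TensorProduct.mk k (H ⊗[k] H) (H ⊗[k] H)).flip (Coalgebra.comul g)))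
        ((Coalgebra.comul : H →ₗ[k] H ⊗[k] H).lTensor H (Coalgebra.comul h)) := by
    simp only [crossedMul, TensorProduct.curry_apply, LinearMap.comp_apply,
      LinearMap.rTensor_tmul, LinearMap.lTensor_tmul]
    congr 2
    generalize (Coalgebra.comul h : H ⊗[k] H) = c
    induction c with
    | zero => simp
    | add c d hc hd => simp only [TensorProduct.tmul_add, TensorProduct.add_tmul, map_add, hc, hd]
    | tmul e f =>
      simp [TensorProduct.comul_tmul,
        TensorProduct.AlgebraTensorModule.tensorTensorTensorComm_eq]
  rw [key, hh, hg]
  simp [TensorProduct.tmul_sum, mul_assoc]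

/-- The data of a crossed product of the algebra `R` with the Hopf algebra `H`:
`H` measures `R` by `act`, the map `σ : H ⊗ H → R` is invertible for the convolution product,
and `R ⊗ H` with the crossed multiplication is an associative algebra with identity `1 # 1`. -/
structure CrossedSystem (k R H : Type*) [Field k] [Ring R] [Algebra k R] [Ring H]
    [HopfAlgebra k H] where
  /-- the action `h · a` -/
  act : H →ₗ[k] R →ₗ[k] R
  /-- `h · (a b) = ∑ (h₁ · a) (h₂ · b)` -/
  act_mul : ∀ (h : H) (a b : R), act h (a * b) =
    LinearMap.mul' k R (TensorProduct.map (act.flip a) (act.flip b) (Coalgebra.comul h))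
  /-- `h · 1 = ε(h) 1` -/
  act_one : ∀ h : H, act h 1 = algebraMap k R (Coalgebra.counit h)
  /-- the map `σ` -/
  σ : H ⊗[k] H →ₗ[k] R
  isUnit_σ : IsUnit (WithConv.toConv σ)
  mul_assoc : ∀ x y z : R ⊗[k] H,
    crossedMul act σ (crossedMul act σ x y) z = crossedMul act σ x (crossedMul act σ y z)
  one_mul : ∀ x : R ⊗[k] H, crossedMul act σ (1 ⊗ₜ[k] 1) x = x
  mul_one : ∀ x : R ⊗[k] H, crossedMul act σ x (1 ⊗ₜ[k] 1) = x

/-- The crossed product `R #_σ H`: the vector space `R ⊗ H` with the crossed multiplication. -/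
def CrossedProduct {k R H : Type*} [Field k] [Ring R] [Algebra k R] [Ring H]
    [HopfAlgebra k H] (_c : CrossedSystem k R H) : Type _ := R ⊗[k] H

noncomputable instance {k R H : Type*} [Field k] [Ring R] [Algebra k R] [Ring H]
    [HopfAlgebra k H] (c : CrossedSystem k R H) : AddCommGroup (CrossedProduct c) :=
  inferInstanceAs (AddCommGroup (R ⊗[k] H))

noncomputable instance {k R H : Type*} [Field k] [Ring R] [Algebra k R] [Ring H]
    [HopfAlgebra k H] (c : CrossedSystem k R H) : Module k (CrossedProduct c) :=
  inferInstanceAs (Module k (R ⊗[k] H))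

noncomputable instance {k R H : Type*} [Field k] [Ring R] [Algebra k R] [Ring H]
    [HopfAlgebra k H] (c : CrossedSystem k R H) : Ring (CrossedProduct c) :=
  { (inferInstance : AddCommGroup (CrossedProduct c)) with
    mul := fun x y => crossedMul c.act c.σ x y
    one := ((1 : R) ⊗ₜ[k] (1 : H) : R ⊗[k] H)
    mul_assoc := c.mul_assoc
    one_mul := c.one_mul
    mul_one := c.mul_one
    left_distrib := fun x y z => map_add (crossedMul c.act c.σ x) y z
    right_distrib := fun x y z => LinearMap.map_add₂ (crossedMul c.act c.σ) x y z
    zero_mul := fun x => LinearMap.map_zero₂ (crossedMul c.act c.σ) x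
    mul_zero := fun x => map_zero (crossedMul c.act c.σ x) }

noncomputable instance {k R H : Type*} [Field k] [Ring R] [Algebra k R] [Ring H]
    [HopfAlgebra k H] (c : CrossedSystem k R H) : Algebra k (CrossedProduct c) :=
  Algebra.ofModule
    (fun r x y => LinearMap.map_smul₂ (crossedMul c.act c.σ) r x y)
    (fun r x y => map_smul (crossedMul c.act c.σ x) r y)

end CrossedProducts

section GlobalDimension

/-- The left global dimension: the supremum of the projective dimensions of all left modules.
The modules range over a universe containing that of `R`; the value is `⊥` for the zero ring. -/
noncomputable def leftGlobalDim (R : Type u) [Ring R] : WithBot ℕ∞ :=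
  ⨆ M : ModuleCat.{max u w} R, CategoryTheory.projectiveDimension M

/-- The right global dimension; right `R`-modules are modules over `Rᵐᵒᵖ`. -/
noncomputable def rightGlobalDim (R : Type u) [Ring R] : WithBot ℕ∞ :=
  leftGlobalDim.{u, w} Rᵐᵒᵖ

end GlobalDimension

section WeakDimension

/-- The subgroup of `M ⊗_ℤ N` generated by all `m r ⊗ n - m ⊗ r n`, for a right `R`-module `M`
and a left `R`-module `N`. -/
def balancedRel (R M N : Type*) [Ring R] [AddCommGroup M] [Module Rᵐᵒᵖ M] [AddCommGroup N]
    [Module R N] : AddSubgroup (M ⊗[ℤ] N) :=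
  AddSubgroup.closure
    {t | ∃ (m : M) (r : R) (n : N), t = (MulOpposite.op r • m) ⊗ₜ[ℤ] n - m ⊗ₜ[ℤ] (r • n)}

/-- The tensor product `M ⊗_R N` of a right and a left module over a ring `R` which need not be
commutative. -/
abbrev BalancedTensor (R M N : Type*) [Ring R] [AddCommGroup M] [Module Rᵐᵒᵖ M] [AddCommGroup N]
    [Module R N] : Type _ :=
  (M ⊗[ℤ] N) ⧸ balancedRel R M N

/-- The map `f ⊗ N : M ⊗_R N → M' ⊗_R N` induced by a map `f` of right modules. -/
def BalancedTensor.map {R M M' : Type*} (N : Type*) [Ring R] [AddCommGroup M] [Module Rᵐᵒᵖ M]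
    [AddCommGroup M'] [Module Rᵐᵒᵖ M'] [AddCommGroup N] [Module R N] (f : M →ₗ[Rᵐᵒᵖ] M') :
    BalancedTensor R M N →+ BalancedTensor R M' N :=
  QuotientAddGroup.map (balancedRel R M N) (balancedRel R M' N)
    (f.toAddMonoidHom.toIntLinearMap.rTensor N).toAddMonoidHom (by
      rw [balancedRel, AddSubgroup.closure_le]
      rintro _ ⟨m, r, n, rfl⟩
      refine AddSubgroup.subset_closure ⟨f m, r, n, ?_⟩
      simp)

/-- A left `R`-module `N` is flat if `- ⊗_R N` preserves injectivity of maps of right modules. -/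
def IsFlatModule (R : Type u) (N : Type v) [Ring R] [AddCommGroup N] [Module R N] : Prop :=
  ∀ (M M' : Type (max u v)) [AddCommGroup M] [Module Rᵐᵒᵖ M] [AddCommGroup M'] [Module Rᵐᵒᵖ M']
    (f : M →ₗ[Rᵐᵒᵖ] M'), Function.Injective f → Function.Injective (BalancedTensor.map N f)

/-- `HasFlatResolution R n M`: there is an exact sequence
`0 → F_n → ⋯ → F_1 → F_0 → M → 0` of left `R`-modules with all `F_i` flat. -/
inductive HasFlatResolution (R : Type u) [Ring R] :
    ℕ → ∀ (M : Type v) [AddCommGroup M] [Module R M], Prop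
  | zero (M : Type v) [AddCommGroup M] [Module R M] (hM : IsFlatModule R M) :
      HasFlatResolution R 0 M
  | succ (n : ℕ) (M F : Type v) [AddCommGroup M] [Module R M] [AddCommGroup F] [Module R F]
      (hF : IsFlatModule R F) (f : F →ₗ[R] M) (hf : Function.Surjective f)
      (hker : HasFlatResolution R n (LinearMap.ker f)) : HasFlatResolution R (n + 1) M

/-- The flat dimension: the least length of a flat resolution, `⊤` if there is no finite one. -/
noncomputable def flatDimension (R : Type u) (M : Type v) [Ring R] [AddCommGroup M]
    [Module R M] : ℕ∞ :=
  ⨅ (n : ℕ) (_ : HasFlatResolution R n M), (n : ℕ∞)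

/-- The weak dimension: the supremum of the flat dimensions of all left modules. -/
noncomputable def weakDim (R : Type u) [Ring R] : ℕ∞ :=
  ⨆ M : ModuleCat.{max u w} R, flatDimension R M

end WeakDimension

section RingClasses

/-- Every left ideal is projective. -/
def IsLeftHereditary (R : Type*) [Ring R] : Prop :=
  ∀ I : Ideal R, Module.Projective R I

/-- Every right ideal is projective. -/
def IsRightHereditary (R : Type*) [Ring R] : Prop :=
  IsLeftHereditary Rᵐᵒᵖ

/-- Every finitely generated left ideal is projective. -/
def IsLeftSemihereditary (R : Type*) [Ring R] : Prop :=
  ∀ I : Ideal R, I.FG → Module.Projective R I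

/-- Every finitely generated right ideal is projective. -/
def IsRightSemihereditary (R : Type*) [Ring R] : Prop :=
  IsLeftSemihereditary Rᵐᵒᵖ

/-- Every element `a` has some `b` with `a b a = a`. -/
def IsVonNeumannRegular (R : Type*) [Ring R] : Prop :=
  ∀ a : R, ∃ b : R, a * b * a = a

end RingClasses

/-! ### Matrix coefficients of a finite-dimensional Hopf algebra -/

section Comatrix

open Coalgebra HopfAlgebra

/-! Everything follows from one property of the extension `φ : R → A`, with `A` the crossed product
or the skew group ring: it is Frobenius, split and separable (`SplitFrobenius`). There is an
`R`-bimodule map `π : A → R` with `π 1 = 1` and dual bases `x`, `y`, and `∑ x i * y i` has a central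
inverse `w`.

For such an extension, `R`-linear maps between `A`-modules can be averaged to `A`-linear ones, as in
Maschke's theorem. Since `A` is finitely generated projective over `R`, and coinduction is also left
adjoint to restriction, an `A`-module is projective or injective over `A` exactly when it is so over
`R`. Dimension shifting extends this to all dimensions. Every `R`-module is a retract of a
restricted `A`-module (`coindEval_comp_coindUnit`), so the suprema agree. Flat dimension becomes
injective dimension of the character module (`hasFlatResolution_iff`). The ring classes transfer by
averaging upwards and applying `π` downwards. Right-hand versions use `SplitFrobenius.op`.

For the crossed product (`CrossedProduct.exists_splitFrobenius`), `π` is `id ⊗ f`, with `f` the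
regular character of `H` divided by `dim H`. The trace `t = ∑ c i i` of the comatrix is an integral
of `H`, and the dual bases are `γ⁻¹(t₁)` and `γ(t₂)` for `γ h = 1 # h`. Then `∑ γ⁻¹(t₁) γ(t₂) = ε(t)
= dim H` is invertible. Commutativity or cocommutativity enters through the twisted antipode
identities, which make `f` and `t` integrals. Working with matrix coefficients turns Sweedler
calculations into matrix identities. -/

/-- The matrix coefficients of the left regular comodule of a coalgebra with respect to a basis. -/
structure IsComatrix {k H ι : Type*} [Field k] [AddCommGroup H] [Module k H] [Coalgebra k H]
    [Fintype ι] (e : Module.Basis ι k H) (c : ι → ι → H) : Prop where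
  comul_basis (j : ι) : (comul (e j) : H ⊗[k] H) = ∑ i, c j i ⊗ₜ e i

theorem IsComatrix.exists {k H ι : Type*} [Field k] [AddCommGroup H] [Module k H]
    [Coalgebra k H] [Fintype ι] (e : Module.Basis ι k H) :
    ∃ c : ι → ι → H, IsComatrix e c := by
  classical
  refine ⟨fun j i => TensorProduct.equivFinsuppOfBasisRight e (comul (e j)) i, ⟨fun j => ?_⟩⟩
  conv_lhs => rw [← (TensorProduct.equivFinsuppOfBasisRight (M := H) e).symm_apply_apply
    (comul (e j)), TensorProduct.equivFinsuppOfBasisRight_symm_apply]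
  rw [Finsupp.sum_fintype _ _ (by simp)]

namespace IsComatrix

section Coalgebra

variable {k H ι : Type*} [Field k] [AddCommGroup H] [Module k H] [Coalgebra k H]
  [Fintype ι] {e : Module.Basis ι k H} {c : ι → ι → H} (hc : IsComatrix e c)

include hc

theorem comul_eq (i j : ι) : (comul (c i j) : H ⊗[k] H) = ∑ l, c i l ⊗ₜ c l j := by
  classical
  -- Compare the coefficients of `e j` in the last tensor factor of coassociativity.
  have h := coassoc_apply (R := k) (e i)
  rw [hc.comul_basis i] at h
  simp only [map_sum, LinearMap.rTensor_tmul, LinearMap.lTensor_tmul, hc.comul_basis,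
    TensorProduct.tmul_sum] at h
  rw [Finset.sum_comm] at h
  have h3 := congrArg (fun z => TensorProduct.equivFinsuppOfBasisRight (M := H ⊗[k] H) e
    ((TensorProduct.assoc k H H H).symm z) j) h
  simpa [TensorProduct.equivFinsuppOfBasisRight_apply_tmul_apply, Finsupp.finsetSum_apply,
    Finsupp.single_apply, ← TensorProduct.sum_tmul] using h3

theorem counit_eq [DecidableEq ι] (i j : ι) :
    counit (R := k) (c i j) = if i = j then 1 else 0 := by
  have h := rTensor_counit_comul (R := k) (e i)
  rw [hc.comul_basis i] at h
  have h3 := congrArg (fun z => e.repr (TensorProduct.lid k H z) j) h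
  simpa [Finsupp.single_apply] using h3

theorem basis_eq (j : ι) : e j = ∑ i, counit (R := k) (e i) • c j i := by
  have h := lTensor_counit_comul (R := k) (e j)
  rw [hc.comul_basis j] at h
  simpa using (congrArg (TensorProduct.rid k H) h).symm

theorem span_eq_top : Submodule.span k (Set.range fun p : ι × ι => c p.1 p.2) = ⊤ := by
  rw [eq_top_iff, ← e.span_eq, Submodule.span_le]
  rintro _ ⟨j, rfl⟩
  rw [hc.basis_eq j]
  exact Submodule.sum_mem _ fun i _ =>
    Submodule.smul_mem _ _ (Submodule.subset_span ⟨(j, i), rfl⟩)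

/-- Matrix coefficients span `H` by the counit axiom, so linear identities need only be checked on
them. -/
theorem hom_ext {M : Type*} [AddCommGroup M] [Module k M] {f g : H →ₗ[k] M}
    (h : ∀ i j, f (c i j) = g (c i j)) : f = g := by
  refine LinearMap.ext_on_range (v := fun p : ι × ι => c p.1 p.2) hc.span_eq_top fun p => h _ _

end Coalgebra

section Hopf

variable {k H ι : Type*} [Field k] [Ring H] [HopfAlgebra k H]
  [Fintype ι] [DecidableEq ι] {e : Module.Basis ι k H} {c : ι → ι → H} (hc : IsComatrix e c)

include hc

theorem sum_antipode_mul (i j : ι) :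
    ∑ l, antipode k (c i l) * c l j = if i = j then 1 else 0 := by
  have h := mul_antipode_rTensor_comul_apply (R := k) (c i j)
  rw [hc.comul_eq, hc.counit_eq] at h
  simpa [apply_ite] using h

theorem sum_mul_antipode (i j : ι) :
    ∑ l, c i l * antipode k (c l j) = if i = j then 1 else 0 := by
  have h := mul_antipode_lTensor_comul_apply (R := k) (c i j)
  rw [hc.comul_eq, hc.counit_eq] at h
  simpa [apply_ite] using h

/-- The two sides are a left and a right inverse of the matrix `comul (c i j)` over `H ⊗ H`, hence
equal. -/
theorem comul_antipode (i j : ι) : (comul (antipode k (c i j)) : H ⊗[k] H)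
    = ∑ l, antipode k (c l j) ⊗ₜ antipode k (c i l) := by
  let D : Matrix ι ι (H ⊗[k] H) := Matrix.of fun i j => comul (c i j)
  let X : Matrix ι ι (H ⊗[k] H) := Matrix.of fun i j => comul (antipode k (c i j))
  let Y : Matrix ι ι (H ⊗[k] H) :=
    Matrix.of fun i j => ∑ l, antipode k (c l j) ⊗ₜ antipode k (c i l)
  have hX : X * D = 1 := by
    ext i j
    simp only [X, D, Matrix.mul_apply, Matrix.of_apply, ← Bialgebra.comul_mul, ← map_sum,
      hc.sum_antipode_mul, Matrix.one_apply]
    split_ifs <;> simp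
  have hY : D * Y = 1 := by
    ext i j
    simp only [Y, D, Matrix.mul_apply, Matrix.of_apply, hc.comul_eq, Finset.sum_mul_sum,
      Algebra.TensorProduct.tmul_mul_tmul, Matrix.one_apply]
    calc ∑ x, ∑ l, ∑ m, (c i l * antipode k (c m j)) ⊗ₜ[k] (c l x * antipode k (c x m))
        = ∑ l, ∑ m, (c i l * antipode k (c m j)) ⊗ₜ[k]
            (∑ x, c l x * antipode k (c x m)) := by
          rw [Finset.sum_comm]
          refine Finset.sum_congr rfl fun l _ => ?_
          rw [Finset.sum_comm]
          simp only [TensorProduct.tmul_sum]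
      _ = _ := by
          simp only [hc.sum_mul_antipode, TensorProduct.tmul_ite,
            Finset.sum_ite_eq, Finset.mem_univ, if_true, ← TensorProduct.sum_tmul]
          split_ifs <;> simp [Algebra.TensorProduct.one_def]
  exact Matrix.ext_iff.mpr (left_inv_eq_right_inv hX hY) i j

/-- In Sweedler notation this is `h₂ S(h₁) = ε(h)`. It reduces to an antipode axiom by swapping the
factors in `H` or the legs of the coproduct. -/
theorem sum_mul_antipode_twisted
    (h : (∀ x y : H, x * y = y * x) ∨ Coalgebra.IsCocomm k H) (i j : ι) :
    ∑ l, c l j * antipode k (c i l) = if i = j then 1 else 0 := by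
  rcases h with h | h
  · rw [← hc.sum_antipode_mul]
    exact Finset.sum_congr rfl fun l _ => h _ _
  · rw [← hc.sum_mul_antipode]
    have := LinearMap.congr_fun (Coalgebra.comm_comp_comul k H) (c i j)
    simp only [LinearMap.comp_apply, hc.comul_eq, map_sum] at this
    simpa using congrArg (LinearMap.mul' k H ∘ₗ (antipode k).lTensor H) this

theorem sum_antipode_mul_twisted
    (h : (∀ x y : H, x * y = y * x) ∨ Coalgebra.IsCocomm k H) (i j : ι) :
    ∑ l, antipode k (c l j) * c i l = if i = j then 1 else 0 := by
  rcases h with h | h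
  · rw [← hc.sum_mul_antipode]
    exact Finset.sum_congr rfl fun l _ => h _ _
  · rw [← hc.sum_antipode_mul]
    have := LinearMap.congr_fun (Coalgebra.comm_comp_comul k H) (c i j)
    simp only [LinearMap.comp_apply, hc.comul_eq, map_sum] at this
    simpa using congrArg (LinearMap.mul' k H ∘ₗ (antipode k).rTensor H) this

theorem antipode_antipode
    (h : (∀ x y : H, x * y = y * x) ∨ Coalgebra.IsCocomm k H) (x : H) :
    antipode k (antipode k x) = x := by
  suffices (antipode k) ∘ₗ (antipode k) = LinearMap.id (R := k) (M := H) from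
    LinearMap.congr_fun this x
  refine hc.hom_ext fun i j => ?_
  -- `S²(c)` is a left inverse of `S(c)`, by applying `S` to the twisted identity, while `c` is a
  -- right inverse.
  let X : Matrix ι ι H := Matrix.of fun i j => antipode k (antipode k (c i j))
  let Y : Matrix ι ι H := Matrix.of fun i j => antipode k (c i j)
  let Z : Matrix ι ι H := Matrix.of c
  have h1 : X * Y = 1 := by
    ext i j
    have := congrArg (antipode k) (hc.sum_mul_antipode_twisted h i j)
    simp only [map_sum, antipode_mul_antidistrib] at this
    simp only [X, Y, Matrix.mul_apply, Matrix.of_apply, this, Matrix.one_apply]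
    split_ifs <;> simp
  have h2 : Y * Z = 1 := by
    ext i j
    simp only [Z, Y, Matrix.mul_apply, Matrix.of_apply, hc.sum_antipode_mul, Matrix.one_apply]
  exact Matrix.ext_iff.mpr (left_inv_eq_right_inv h1 h2) i j

end Hopf

end IsComatrix

end Comatrix

/-! ### Integrals from the regular character and the comatrix trace -/

section Integrals

open Coalgebra HopfAlgebra

/-- The character of the regular representation. -/
noncomputable def regularTrace (k H : Type*) [Field k] [Ring H] [Algebra k H] : H →ₗ[k] k :=
  LinearMap.trace k H ∘ₗ LinearMap.mul k H

namespace IsComatrix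

variable {k H ι : Type*} [Field k] [Ring H] [HopfAlgebra k H]
  [Fintype ι] [DecidableEq ι] {e : Module.Basis ι k H} {c : ι → ι → H} (hc : IsComatrix e c)

theorem _root_.regularTrace_eq_sum (e : Module.Basis ι k H) (h : H) :
    regularTrace k H h = ∑ i, e.repr (h * e i) i := by
  simp [regularTrace, LinearMap.trace_eq_matrix_trace k e, Matrix.trace, LinearMap.toMatrix_apply]

theorem _root_.regularTrace_one [FiniteDimensional k H] :
    regularTrace k H 1 = Module.finrank k H := by
  have : LinearMap.mul k H 1 = LinearMap.id := by ext; simp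
  rw [regularTrace, LinearMap.comp_apply, this, LinearMap.trace_id]

include hc

theorem sum_repr_smul (j : ι) (x : H) : ∑ m, e.repr x m • c m j
      = TensorProduct.rid k H ((e.coord j).lTensor H (comul x)) := by
  conv_rhs => rw [← e.sum_repr x]
  simp only [map_sum, map_smul, hc.comul_basis, LinearMap.lTensor_tmul, TensorProduct.rid_tmul,
    Module.Basis.coord_apply, e.repr_self, Finsupp.single_apply, ite_smul, one_smul, zero_smul,
    Finset.sum_ite_eq', Finset.mem_univ, if_true]

/-- Multiplicativity of the coproduct, read through the `n`-th coordinate of the second leg of `Δ(c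
p q * e j)`. -/
theorem sum_repr_mul_basis_smul (j n p q : ι) :
    ∑ r, ∑ i, e.repr (c r q * e i) n • (c p r * c j i)
      = ∑ m, e.repr (c p q * e j) m • c m n := by
  rw [hc.sum_repr_smul, Bialgebra.comul_mul, hc.comul_eq, hc.comul_basis]
  simp [Finset.sum_mul_sum]

theorem sum_repr_basis_mul_smul (j n p q : ι) :
    ∑ r, ∑ i, e.repr (e i * c r q) n • (c j i * c p r)
      = ∑ m, e.repr (e j * c p q) m • c m n := by
  rw [hc.sum_repr_smul, Bialgebra.comul_mul, hc.comul_eq, hc.comul_basis]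
  simp only [Finset.sum_mul_sum, Algebra.TensorProduct.tmul_mul_tmul, map_sum,
    LinearMap.lTensor_tmul, TensorProduct.rid_tmul, Module.Basis.coord_apply]
  rw [Finset.sum_comm]

/-- The regular character is an integral in the dual: `h₁ f(h₂) = f(h) 1`. Multiply the previous
matrix identity by `antipode k (c n j)` and sum over `n` and `j`. The twisted antipode identity
collapses one side and the ordinary one the other, each leaving a trace. -/
theorem sum_regularTrace_smul
    (h : (∀ x y : H, x * y = y * x) ∨ Coalgebra.IsCocomm k H) (p q : ι) :
    ∑ r, regularTrace k H (c r q) • c p r = regularTrace k H (c p q) • (1 : H) := by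
  have key : ∑ n, ∑ j, (∑ r, ∑ i, e.repr (c r q * e i) n • (c p r * c j i)) * antipode k (c n j)
      = ∑ n, ∑ j, (∑ m, e.repr (c p q * e j) m • c m n) * antipode k (c n j) := by
    simp only [hc.sum_repr_mul_basis_smul]
  have h1 : ∀ n, ∑ j, (∑ r, ∑ i, e.repr (c r q * e i) n • (c p r * c j i)) * antipode k (c n j)
      = ∑ r, e.repr (c r q * e n) n • c p r := by
    intro n
    calc _ = ∑ r, ∑ i, e.repr (c r q * e i) n • (c p r * ∑ j, c j i * antipode k (c n j)) := by
          simp only [Finset.sum_mul, Finset.mul_sum, Finset.smul_sum, smul_mul_assoc, mul_assoc]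
          rw [Finset.sum_comm]
          exact Finset.sum_congr rfl fun r _ => Finset.sum_comm
      _ = _ := by simp [hc.sum_mul_antipode_twisted h]
  have h2 : ∑ n, ∑ j, (∑ m, e.repr (c p q * e j) m • c m n) * antipode k (c n j)
      = ∑ j, e.repr (c p q * e j) j • (1 : H) := by
    calc _ = ∑ j, ∑ m, e.repr (c p q * e j) m • ∑ n, c m n * antipode k (c n j) := by
          simp only [Finset.sum_mul, Finset.smul_sum, smul_mul_assoc]
          rw [Finset.sum_comm]
          exact Finset.sum_congr rfl fun r _ => Finset.sum_comm
      _ = _ := by simp [hc.sum_mul_antipode]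
  rw [h2] at key
  simp only [h1] at key
  rw [Finset.sum_comm] at key
  simpa only [regularTrace_eq_sum e, Finset.sum_smul] using key

/-- Dual to the integral property of the regular character. The coproduct identity for `e j * c p q`
is contracted with the matrix of right multiplication by `antipode k (c q t)`. One contraction uses
`h₁ S(h₂) = ε(h)`, the other `S(h₂) h₁ = ε(h)`. -/
theorem sum_diag_mul
    (h : (∀ x y : H, x * y = y * x) ∨ Coalgebra.IsCocomm k H) (x : H) :
    (∑ i, c i i) * x = counit (R := k) x • ∑ i, c i i := by
  suffices LinearMap.mulLeft k (∑ i, c i i)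
      = (counit (R := k) (A := H)).smulRight (∑ i, c i i) from LinearMap.congr_fun this x
  refine hc.hom_ext fun p t => ?_
  simp only [LinearMap.mulLeft_apply, LinearMap.smulRight_apply]
  have key : ∑ j, ∑ q, ∑ n, e.repr (e n * antipode k (c q t)) j •
        (∑ r, ∑ i, e.repr (e i * c r q) n • (c j i * c p r))
      = ∑ j, ∑ q, ∑ n, e.repr (e n * antipode k (c q t)) j •
        (∑ m, e.repr (e j * c p q) m • c m n) := by
    simp only [hc.sum_repr_basis_mul_smul]
  have expand : ∀ (x y : H) (j : ι), e.repr (x * y) j = ∑ n, e.repr x n * e.repr (e n * y) j := by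
    intro x y j
    conv_lhs => rw [← e.sum_repr x]
    simp only [Finset.sum_mul, map_sum, map_smul, Finsupp.finsetSum_apply, smul_mul_assoc,
      Finsupp.smul_apply, smul_eq_mul]
  have h1 : ∀ j, ∑ q, ∑ n, e.repr (e n * antipode k (c q t)) j •
        (∑ r, ∑ i, e.repr (e i * c r q) n • (c j i * c p r)) = c j j * c p t := by
    intro j
    calc _ = ∑ r, ∑ i, ∑ q, (∑ n, e.repr (e i * c r q) n * e.repr (e n * antipode k (c q t)) j) •
            (c j i * c p r) := by
          simp only [Finset.smul_sum, Finset.sum_smul, smul_smul]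
          rw [Finset.sum_congr rfl fun q _ => Finset.sum_comm, Finset.sum_comm]
          refine Finset.sum_congr rfl fun r _ => ?_
          rw [Finset.sum_congr rfl fun q _ => Finset.sum_comm, Finset.sum_comm]
          simp only [mul_comm]
      _ = ∑ r, ∑ i, e.repr (e i * ∑ q, c r q * antipode k (c q t)) j • (c j i * c p r) := by
          simp only [← expand, Finset.mul_sum, map_sum, Finsupp.finsetSum_apply, Finset.sum_smul,
            mul_assoc]
      _ = _ := by
          rw [Finset.sum_eq_single t, Finset.sum_eq_single j]
          · simp [hc.sum_mul_antipode]
          · intro i _ hi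
            simp [hc.sum_mul_antipode, hi]
          · simp
          · intro r _ hr
            simp [hc.sum_mul_antipode, hr]
          · simp
  have h2 : ∑ j, ∑ q, ∑ n, e.repr (e n * antipode k (c q t)) j •
        (∑ m, e.repr (e j * c p q) m • c m n) = counit (R := k) (c p t) • ∑ i, c i i := by
    calc _ = ∑ n, ∑ m, ∑ q, (∑ j, e.repr (e n * antipode k (c q t)) j * e.repr (e j * c p q) m) •
            c m n := by
          simp only [Finset.smul_sum, Finset.sum_smul, smul_smul]
          rw [Finset.sum_congr rfl fun q _ => Finset.sum_comm, Finset.sum_comm]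
          refine Finset.sum_congr rfl fun r _ => ?_
          rw [Finset.sum_congr rfl fun q _ => Finset.sum_congr rfl fun q _ => rfl, Finset.sum_comm,
            Finset.sum_congr rfl fun q _ => Finset.sum_comm, Finset.sum_comm]
      _ = ∑ n, ∑ m, e.repr (e n * ∑ q, antipode k (c q t) * c p q) m • c m n := by
          simp only [← expand, Finset.mul_sum, map_sum, Finsupp.finsetSum_apply, Finset.sum_smul,
            mul_assoc]
      _ = _ := by
          simp only [hc.sum_antipode_mul_twisted h, hc.counit_eq]
          split_ifs <;> simp [Finsupp.single_apply]
  rw [h2] at key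
  simp only [h1] at key
  rw [Finset.sum_mul, key]

theorem counit_sum_diag [FiniteDimensional k H] :
    counit (R := k) (∑ i, c i i) = (Module.finrank k H : k) := by
  simp [hc.counit_eq, Module.finrank_eq_card_basis e]

theorem regularTrace_sum_diag [FiniteDimensional k H]
    (h : (∀ x y : H, x * y = y * x) ∨ Coalgebra.IsCocomm k H) :
    regularTrace k H (∑ i, c i i) = (Module.finrank k H : k) := by
  -- Left multiplication by this integral has rank at most one, so its trace is a value of the
  -- counit.
  have : LinearMap.mul k H (∑ i, c i i)
      = (counit (R := k) (A := H)).smulRight (∑ i, c i i) :=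
    LinearMap.ext fun x => hc.sum_diag_mul h x
  rw [regularTrace, LinearMap.comp_apply, this, LinearMap.trace_smulRight, hc.counit_sum_diag]

theorem mul_antipode_sum_diag
    (h : (∀ x y : H, x * y = y * x) ∨ Coalgebra.IsCocomm k H) (x : H) :
    x * antipode k (∑ i, c i i) = counit (R := k) x • antipode k (∑ i, c i i) := by
  have := congrArg (antipode k) (hc.sum_diag_mul h (antipode k x))
  rwa [antipode_mul_antidistrib, hc.antipode_antipode h, map_smul, counit_antipode] at this

/-- With `t` the comatrix trace, evaluate `t * S(t)` by absorbing either factor: `dim H • S(t) = dim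
H • t`, and `dim H` cancels. -/
theorem antipode_sum_diag [FiniteDimensional k H]
    (h : (∀ x y : H, x * y = y * x) ∨ Coalgebra.IsCocomm k H)
    (hd : (Module.finrank k H : k) ≠ 0) : antipode k (∑ i, c i i) = ∑ i, c i i := by
  have h1 := hc.sum_diag_mul h (antipode k (∑ i, c i i))
  rw [hc.mul_antipode_sum_diag h, counit_antipode, hc.counit_sum_diag] at h1
  exact smul_right_injective H hd h1

end IsComatrix

end Integrals

/-! ### Split separable Frobenius extensions -/

section SplitFrobenius

/-- A Frobenius extension `φ : R → A` with Frobenius homomorphism `π` and dual bases `x`, `y`, which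
is split (`π 1 = 1`) and separable (`∑ x i * y i` is the inverse of a central element `w`). -/
structure SplitFrobenius {R A : Type*} [Ring R] [Ring A] (φ : R →+* A) (ι : Type*) [Fintype ι] where
  π : A →+ R
  π_mul_left : ∀ r a, π (φ r * a) = r * π a
  π_mul_right : ∀ a r, π (a * φ r) = π a * r
  π_one : π 1 = 1
  x : ι → A
  y : ι → A
  sum_left : ∀ a, ∑ i, x i * φ (π (y i * a)) = a
  sum_right : ∀ a, ∑ i, φ (π (a * x i)) * y i = a
  w : A
  w_comm : ∀ a, a * w = w * a
  sum_mul_w : (∑ i, x i * y i) * w = 1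

end SplitFrobenius

/-! ### Multiplication and coaction on the crossed product -/

section CrossedProducts

open Coalgebra HopfAlgebra

/-- A matrix over a coalgebra with `Δ d = d ⊗ d` and `ε d = 1` in the sense of matrix products. -/
structure IsMultiplicative (k : Type*) {H ι : Type*} [Field k] [AddCommGroup H] [Module k H]
    [Coalgebra k H] [Fintype ι] [DecidableEq ι] (d : ι → ι → H) : Prop where
  comul_eq (i j : ι) : (comul (d i j) : H ⊗[k] H) = ∑ l, d i l ⊗ₜ d l j
  counit_eq (i j : ι) : counit (R := k) (d i j) = if i = j then 1 else 0

theorem IsComatrix.isMultiplicative {k H ι : Type*} [Field k] [AddCommGroup H] [Module k H]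
    [Coalgebra k H] [Fintype ι] [DecidableEq ι] {e : Module.Basis ι k H} {c : ι → ι → H}
    (hc : IsComatrix e c) : IsMultiplicative k c :=
  ⟨hc.comul_eq, hc.counit_eq⟩

/-- The antipode reverses coproducts, hence the transpose. This lets the product formulas below
apply to `1 # S h` as well. -/
theorem IsComatrix.isMultiplicative_antipode {k H ι : Type*} [Field k] [Ring H] [HopfAlgebra k H]
    [Fintype ι] [DecidableEq ι] {e : Module.Basis ι k H} {c : ι → ι → H}
    (hc : IsComatrix e c) : IsMultiplicative k fun i j => antipode k (c j i) :=
  ⟨fun i j => hc.comul_antipode j i, fun i j => by simp [hc.counit_eq, eq_comm]⟩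

namespace CrossedProduct

variable {k R H ι : Type*} [Field k] [Ring R] [Algebra k R] [Ring H] [HopfAlgebra k H]
  [Fintype ι] [DecidableEq ι] (S : CrossedSystem k R H)

/-- The element `a # h` of the crossed product. -/
noncomputable def mk : R →ₗ[k] H →ₗ[k] CrossedProduct S := TensorProduct.mk k R H

/-- The map `a # h ↦ f h • a`. -/
noncomputable def evalRight (f : H →ₗ[k] k) : CrossedProduct S →ₗ[k] R :=
  (TensorProduct.rid k R).toLinearMap ∘ₗ f.lTensor R

@[simp]
theorem evalRight_mk (f : H →ₗ[k] k) (a : R) (h : H) : evalRight S f (mk S a h) = f h • a :=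
  TensorProduct.rid_tmul _ _

theorem one_eq_mk : (1 : CrossedProduct S) = mk S 1 1 := rfl

variable {S}

omit [DecidableEq ι] in
theorem hom_ext {e : Module.Basis ι k H} {c : ι → ι → H} (hc : IsComatrix e c)
    {M : Type*} [AddCommGroup M] [Module k M] {f g : CrossedProduct S →ₗ[k] M}
    (h : ∀ a i j, f (mk S a (c i j)) = g (mk S a (c i j))) : f = g :=
  TensorProduct.ext (LinearMap.ext fun a => hc.hom_ext fun i j => h a i j)

theorem mk_mul_mk {d d' : ι → ι → H} (hd : IsMultiplicative k d) (hd' : IsMultiplicative k d')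
    (a b : R) (i j p q : ι) : mk S a (d i j) * mk S b (d' p q)
      = ∑ l, ∑ m, ∑ r, mk S (a * S.act (d i l) b * S.σ (d l m ⊗ₜ d' p r)) (d m j * d' r q) := by
  refine (crossedMul_tmul_tmul S.act S.σ a b (d i j) (d' p q) (Finset.univ : Finset (ι × ι))
    Finset.univ (fun z => d i z.1) (fun z => d z.1 z.2) (fun z => d z.2 j)
    (fun r => d' p r) (fun r => d' r q) ?_ (hd'.comul_eq p q)).trans ?_
  · simp [hd.comul_eq, TensorProduct.tmul_sum, Fintype.sum_prod_type]
  · rw [Fintype.sum_prod_type]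
    rfl

theorem one_mk_mul_mk {d' : ι → ι → H} (hd' : IsMultiplicative k d')
    (a b : R) (p q : ι) : mk S a 1 * mk S b (d' p q)
      = ∑ r, mk S (a * S.act 1 b * S.σ (1 ⊗ₜ d' p r)) (d' r q) := by
  refine (crossedMul_tmul_tmul S.act S.σ a b 1 (d' p q) (Finset.univ : Finset Unit)
    Finset.univ (fun z => 1) (fun z => 1) (fun z => 1)
    (fun r => d' p r) (fun r => d' r q) ?_ (hd'.comul_eq p q)).trans ?_
  · simp [Algebra.TensorProduct.one_def]
  · simp only [Finset.univ_unique, Finset.sum_singleton, one_mul]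
    rfl

theorem mk_mul_one_mk {d : ι → ι → H} (hd : IsMultiplicative k d)
    (a b : R) (i j : ι) : mk S a (d i j) * mk S b 1
      = ∑ l, ∑ m, mk S (a * S.act (d i l) b * S.σ (d l m ⊗ₜ 1)) (d m j) := by
  refine (crossedMul_tmul_tmul S.act S.σ a b (d i j) 1 (Finset.univ : Finset (ι × ι))
    (Finset.univ : Finset Unit) (fun z => d i z.1) (fun z => d z.1 z.2) (fun z => d z.2 j)
    (fun r => 1) (fun r => 1) ?_ ?_).trans ?_
  · simp [hd.comul_eq, TensorProduct.tmul_sum, Fintype.sum_prod_type]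
  · simp [Algebra.TensorProduct.one_def]
  · rw [Fintype.sum_prod_type]
    simp only [Finset.univ_unique, Finset.sum_singleton, mul_one]
    rfl

theorem one_mk_mul_one_mk (a b : R) : mk S a 1 * mk S b 1
      = mk S (a * S.act 1 b * S.σ (1 ⊗ₜ 1)) 1 := by
  refine (crossedMul_tmul_tmul S.act S.σ a b 1 1 (Finset.univ : Finset Unit)
    (Finset.univ : Finset Unit) (fun z => 1) (fun z => 1) (fun z => 1)
    (fun r => 1) (fun r => 1) ?_ ?_).trans ?_
  · simp [Algebra.TensorProduct.one_def]
  · simp [Algebra.TensorProduct.one_def]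
  · simp only [Finset.univ_unique, Finset.sum_singleton, mul_one]
    rfl

/-- The normalisations of `σ` and of the action are not axioms. They are extracted from `1 # 1`
being an identity by applying `id ⊗ ε`; the next lemmas do the same. -/
theorem sigma_one_one : S.σ (1 ⊗ₜ 1) = 1 := by
  have h : mk S 1 1 * mk S 1 1 = mk S 1 1 := by rw [← one_eq_mk, one_mul]
  rw [one_mk_mul_one_mk, S.act_one] at h
  simpa using congrArg (evalRight S (counit (R := k))) h

theorem act_one_left (b : R) : S.act 1 b = b := by
  have h : mk S 1 1 * mk S b 1 = mk S b 1 := by rw [← one_eq_mk, one_mul]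
  rw [one_mk_mul_one_mk, sigma_one_one] at h
  simpa using congrArg (evalRight S (counit (R := k))) h

theorem sigma_one_left {d : ι → ι → H} (hd : IsMultiplicative k d) (p q : ι) :
    S.σ (1 ⊗ₜ d p q) = if p = q then 1 else 0 := by
  have h : mk S 1 1 * mk S 1 (d p q) = mk S 1 (d p q) := by rw [← one_eq_mk, one_mul]
  rw [one_mk_mul_mk hd, act_one_left] at h
  simpa [hd.counit_eq] using congrArg (evalRight S (counit (R := k))) h

theorem sigma_one_right {d : ι → ι → H} (hd : IsMultiplicative k d) (p q : ι) :
    S.σ (d p q ⊗ₜ 1) = if p = q then 1 else 0 := by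
  have h : mk S 1 (d p q) * mk S 1 1 = mk S 1 (d p q) := by rw [← one_eq_mk, mul_one]
  rw [mk_mul_one_mk hd, Finset.sum_eq_single p] at h
  · simpa [hd.counit_eq, S.act_one] using congrArg (evalRight S (counit (R := k))) h
  · intro l _ hl
    simp [hd.counit_eq, S.act_one, hl.symm]
  · simp

theorem one_mk_mul {e : Module.Basis ι k H} {c : ι → ι → H} (hc : IsComatrix e c) (a b : R)
    (g : H) : mk S a 1 * mk S b g = mk S (a * b) g := by
  suffices LinearMap.mulLeft k (mk S a 1) ∘ₗ mk S b = mk S (a * b) from LinearMap.congr_fun this g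
  refine hc.hom_ext fun i j => ?_
  simp only [LinearMap.comp_apply, LinearMap.mulLeft_apply, one_mk_mul_mk hc.isMultiplicative,
    act_one_left, sigma_one_left hc.isMultiplicative]
  rw [Finset.sum_eq_single i] <;> simp +contextual [eq_comm]

theorem mk_mul_one {d : ι → ι → H} (hd : IsMultiplicative k d) (a b : R) (i j : ι) :
    mk S a (d i j) * mk S b 1 = ∑ l, mk S (a * S.act (d i l) b) (d l j) := by
  rw [mk_mul_one_mk hd]
  refine Finset.sum_congr rfl fun l _ => ?_
  rw [Finset.sum_eq_single l] <;> simp +contextual [sigma_one_right hd, eq_comm]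

theorem mk_one_mul_mk_one {d d' : ι → ι → H} (hd : IsMultiplicative k d)
    (hd' : IsMultiplicative k d') (i j p q : ι) : mk S 1 (d i j) * mk S 1 (d' p q)
      = ∑ m, ∑ r, mk S (S.σ (d i m ⊗ₜ d' p r)) (d m j * d' r q) := by
  rw [mk_mul_mk hd hd', Finset.sum_eq_single i]
  · simp [S.act_one, hd.counit_eq]
  · intro l _ hl
    simp [S.act_one, hd.counit_eq, hl.symm]
  · simp

variable (S) in
/-- The coaction `a # h ↦ ∑ a # h₁ ⊗ h₂`. -/
noncomputable def coaction : CrossedProduct S →ₗ[k] CrossedProduct S ⊗[k] H :=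
  (TensorProduct.assoc k R H H).symm.toLinearMap ∘ₗ (comul : H →ₗ[k] H ⊗[k] H).lTensor R

theorem coaction_mk_eq_rTensor (a : R) (h : H) :
    coaction S (mk S a h) = (mk S a).rTensor H (comul h) := by
  change (TensorProduct.assoc k R H H).symm (a ⊗ₜ[k] comul h) = _
  induction (comul h : H ⊗[k] H) with
  | zero =>
    rw [TensorProduct.tmul_zero, map_zero, map_zero]
    rfl
  | add x y hx hy =>
    rw [TensorProduct.tmul_add, map_add, map_add, ← hx, ← hy]
    rfl
  | tmul x y => rfl

theorem coaction_mk {d : ι → ι → H} (hd : IsMultiplicative k d) (a : R) (i j : ι) :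
    coaction S (mk S a (d i j)) = ∑ l, mk S a (d i l) ⊗ₜ d l j := by
  simp [coaction_mk_eq_rTensor, hd.comul_eq]

theorem coaction_mk_mul {d d' : ι → ι → H} (hd : IsMultiplicative k d)
    (hd' : IsMultiplicative k d') (a : R) (i j p q : ι) :
    coaction S (mk S a (d i j * d' p q))
      = ∑ l, ∑ r, mk S a (d i l * d' p r) ⊗ₜ (d l j * d' r q) := by
  simp [coaction_mk_eq_rTensor, hd.comul_eq, hd'.comul_eq, Finset.sum_mul_sum]

/-- The crossed product is a comodule algebra: only the last legs `h₃` and `g₂` of the product reach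
the `H` factor, and the coproduct of `H` is multiplicative there. What remains is a reordering of
sums. -/
theorem coaction_mul {e : Module.Basis ι k H} {c : ι → ι → H} (hc : IsComatrix e c)
    (x y : CrossedProduct S) : coaction S (x * y) = coaction S x * coaction S y := by
  have hd := hc.isMultiplicative
  suffices coaction S ∘ₗ LinearMap.mulRight k y
      = LinearMap.mulRight k (coaction S y) ∘ₗ coaction S from LinearMap.congr_fun this x
  refine hom_ext hc fun a i j => ?_
  suffices coaction S ∘ₗ LinearMap.mulLeft k (mk S a (c i j))
      = LinearMap.mulLeft k (coaction S (mk S a (c i j))) ∘ₗ coaction S from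
    LinearMap.congr_fun this y
  refine hom_ext hc fun b p q => ?_
  simp only [LinearMap.comp_apply, LinearMap.mulLeft_apply]
  simp only [mk_mul_mk hd hd, map_sum, coaction_mk hd, coaction_mk_mul hd hd, Finset.sum_mul_sum, Algebra.TensorProduct.tmul_mul_tmul,
    TensorProduct.sum_tmul]
  calc _ = ∑ l, ∑ m, ∑ n, ∑ r, ∑ s, mk S (a * S.act (c i l) b * S.σ (c l m ⊗ₜ c p r))
          (c m n * c r s) ⊗ₜ[k] (c n j * c s q) :=
        Finset.sum_congr rfl fun l _ => Finset.sum_congr rfl fun m _ => Finset.sum_comm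
    _ = ∑ n, ∑ l, ∑ m, ∑ s, ∑ r, mk S (a * S.act (c i l) b * S.σ (c l m ⊗ₜ c p r))
          (c m n * c r s) ⊗ₜ[k] (c n j * c s q) := by
        rw [Finset.sum_congr rfl fun l _ => Finset.sum_comm, Finset.sum_comm]
        exact Finset.sum_congr rfl fun n _ => Finset.sum_congr rfl fun l _ =>
          Finset.sum_congr rfl fun m _ => Finset.sum_comm
    _ = _ := by
        refine Finset.sum_congr rfl fun n _ => ?_
        rw [Finset.sum_congr rfl fun l _ => Finset.sum_comm, Finset.sum_comm]

end CrossedProduct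

end CrossedProducts

/-! ### Frobenius structure of the crossed product -/

section CrossedProducts

open Coalgebra HopfAlgebra

namespace CrossedProduct

variable {k R H ι : Type*} [Field k] [Ring R] [Algebra k R] [Ring H] [HopfAlgebra k H]
  [Fintype ι] [DecidableEq ι] {S : CrossedSystem k R H}

theorem evalRight_one_mk_mul {e : Module.Basis ι k H} {c : ι → ι → H} (hc : IsComatrix e c)
    (f : H →ₗ[k] k) (r : R) (x : CrossedProduct S) :
    evalRight S f (mk S r 1 * x) = r * evalRight S f x := by
  suffices evalRight S f ∘ₗ LinearMap.mulLeft k (mk S r 1) = LinearMap.mulLeft k r ∘ₗ evalRight S f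
    from LinearMap.congr_fun this x
  refine hom_ext hc fun a i j => ?_
  simp [one_mk_mul hc]

/-- Here `(a # h)(r # 1) = ∑ a (h₁ · r) # h₂`, and `h₁ f(h₂) = f(h) 1` leaves the action of `1` on
`r`. -/
theorem evalRight_mul_mk_one {e : Module.Basis ι k H} {c : ι → ι → H} (hc : IsComatrix e c)
    {f : H →ₗ[k] k} (hf : ∀ p q, ∑ r, f (c r q) • c p r = f (c p q) • (1 : H))
    (x : CrossedProduct S) (r : R) :
    evalRight S f (x * mk S r 1) = evalRight S f x * r := by
  suffices evalRight S f ∘ₗ LinearMap.mulRight k (mk S r 1)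
      = LinearMap.mulRight k r ∘ₗ evalRight S f from LinearMap.congr_fun this x
  refine hom_ext hc fun a i j => ?_
  have := congrArg (fun h => a * S.act h r) (hf i j)
  simp only [map_sum, LinearMap.sum_apply, map_smul, LinearMap.smul_apply, act_one_left,
    Finset.mul_sum, mul_smul_comm] at this
  simp [mk_mul_one hc.isMultiplicative, this]

/-- Writing `π` through the multiplicative coaction reduces the dual basis identities to
computations in `H`. -/
theorem evalRight_eq_coaction {e : Module.Basis ι k H} {c : ι → ι → H} (hc : IsComatrix e c)
    {f : H →ₗ[k] k} (hf : ∀ p q, ∑ r, f (c r q) • c p r = f (c p q) • (1 : H))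
    (x : CrossedProduct S) :
    mk S (evalRight S f x) 1 = TensorProduct.rid k _ (f.lTensor _ (coaction S x)) := by
  suffices (mk S).flip 1 ∘ₗ evalRight S f
      = (TensorProduct.rid k _).toLinearMap ∘ₗ f.lTensor _ ∘ₗ coaction S from
    LinearMap.congr_fun this x
  refine hom_ext hc fun a i j => ?_
  have := congrArg (mk S a) (hf i j)
  simp only [map_sum, map_smul] at this
  simp [coaction_mk hc.isMultiplicative, this]

theorem counit_coaction {e : Module.Basis ι k H} {c : ι → ι → H} (hc : IsComatrix e c)
    (x : CrossedProduct S) :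
    TensorProduct.rid k _ ((counit (R := k) (A := H)).lTensor _ (coaction S x)) = x := by
  suffices (TensorProduct.rid k _).toLinearMap ∘ₗ (counit (R := k) (A := H)).lTensor _ ∘ₗ
      coaction S = LinearMap.id from LinearMap.congr_fun this x
  refine hom_ext hc fun a i j => ?_
  simp [coaction_mk hc.isMultiplicative, hc.counit_eq]

variable (S) in
/-- The values on matrix coefficients of the convolution inverse
`h ↦ ∑ σ⁻¹ (S h₂, h₃) # S h₁` of `h ↦ 1 # h`. -/
noncomputable def cleftInv (τ : H ⊗[k] H →ₗ[k] R) (c : ι → ι → H) (i j : ι) : CrossedProduct S :=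
  ∑ p, ∑ q, mk S (τ (antipode k (c p q) ⊗ₜ c q j)) (antipode k (c i p))

theorem coaction_cleftInv {e : Module.Basis ι k H} {c : ι → ι → H} (hc : IsComatrix e c)
    (τ : H ⊗[k] H →ₗ[k] R) (i j : ι) :
    coaction S (cleftInv S τ c i j) = ∑ l, cleftInv S τ c l j ⊗ₜ antipode k (c i l) := by
  have h (a : R) (i p : ι) := coaction_mk hc.isMultiplicative_antipode (S := S) a p i
  simp only [cleftInv, map_sum, h, TensorProduct.sum_tmul]
  rw [Finset.sum_congr rfl fun l _ => Finset.sum_comm, Finset.sum_comm]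

/-- This is `γ⁻¹(h₁) γ(h₂) = ε(h)`. The product creates values of the convolution `τ * σ`, which
collapse to counits and leave `S(h₁) h₂`. -/
theorem sum_cleftInv_mul {e : Module.Basis ι k H} {c : ι → ι → H} (hc : IsComatrix e c)
    {τ : H ⊗[k] H →ₗ[k] R} (hτ : WithConv.toConv τ * WithConv.toConv S.σ = 1) (i j : ι) :
    ∑ l, cleftInv S τ c i l * mk S 1 (c l j) = if i = j then 1 else 0 := by
  -- Evaluate `τ * σ = 1` at `S(c p q) ⊗ c s r`; the first indices appear reversed because `S` flips
  -- the coproduct.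
  have hconv (p r q s : ι) : ∑ l, ∑ m, τ (antipode k (c l q) ⊗ₜ c s m) *
      S.σ (antipode k (c p l) ⊗ₜ c m r) = if p = q then (if s = r then 1 else 0) else 0 := by
    have := congrArg (fun f : WithConv (H ⊗[k] H →ₗ[k] R) => f (antipode k (c p q) ⊗ₜ[k] c s r)) hτ
    simp only [LinearMap.convMul_apply, LinearMap.convOne_apply, TensorProduct.comul_tmul,
      hc.comul_antipode, hc.comul_eq, TensorProduct.counit_tmul, counit_antipode,
      hc.counit_eq, TensorProduct.sum_tmul, TensorProduct.tmul_sum, map_sum] at this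
    simp only [TensorProduct.AlgebraTensorModule.tensorTensorTensorComm_tmul,
      TensorProduct.map_tmul, LinearMap.mul'_apply] at this
    rw [Finset.sum_comm] at this
    simpa [apply_ite] using this
  calc _ = ∑ l, ∑ p, ∑ q, mk S (τ (antipode k (c p q) ⊗ₜ c q l)) 1 *
        (mk S 1 (antipode k (c i p)) * mk S 1 (c l j)) := by
        simp only [cleftInv, Finset.sum_mul, ← mul_assoc, one_mk_mul hc, mul_one]
    _ = ∑ l, ∑ p, ∑ q, ∑ m, ∑ r, mk S (τ (antipode k (c p q) ⊗ₜ c q l) *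
        S.σ (antipode k (c m p) ⊗ₜ c l r)) (antipode k (c i m) * c r j) := by
        simp only [mk_one_mul_mk_one hc.isMultiplicative_antipode hc.isMultiplicative,
          Finset.mul_sum, one_mk_mul hc]
    _ = ∑ m, ∑ r, ∑ q, mk S (∑ p, ∑ l, τ (antipode k (c p q) ⊗ₜ c q l) *
        S.σ (antipode k (c m p) ⊗ₜ c l r)) (antipode k (c i m) * c r j) := by
        simp only [map_sum, LinearMap.sum_apply]
        rw [Finset.sum_congr rfl fun l _ => Finset.sum_congr rfl fun p _ => Finset.sum_comm,
          Finset.sum_congr rfl fun l _ => Finset.sum_comm, Finset.sum_comm]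
        refine Finset.sum_congr rfl fun m _ => ?_
        rw [Finset.sum_congr rfl fun l _ => Finset.sum_congr rfl fun p _ => Finset.sum_comm,
          Finset.sum_congr rfl fun l _ => Finset.sum_comm, Finset.sum_comm]
        refine Finset.sum_congr rfl fun r _ => ?_
        rw [Finset.sum_congr rfl fun l _ => Finset.sum_comm, Finset.sum_comm]
        exact Finset.sum_congr rfl fun q _ => Finset.sum_comm
    _ = ∑ m, mk S 1 (antipode k (c i m) * c m j) := by
        refine Finset.sum_congr rfl fun m _ => ?_
        simp only [hconv]
        rw [Finset.sum_eq_single m, Finset.sum_eq_single m]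
        · simp
        · simp +contextual [eq_comm]
        · simp
        · intro r _ hr
          refine Finset.sum_eq_zero fun q _ => ?_
          by_cases h : m = q
          · simp [← h, hr.symm]
          · simp [h]
        · simp
    _ = _ := by
        rw [← map_sum, hc.sum_antipode_mul]
        split_ifs
        · exact (one_eq_mk S).symm
        · simp

/-- With `ρ(a) = a₀ ⊗ a₁` and `t` the comatrix trace, the sum is `γ⁻¹(t₁) γ(t₂) a₀ f(t₃ a₁) = a₀ f(t
a₁) = a₀ ε(a₁)`. -/
theorem sum_cleftInv_mul_evalRight {e : Module.Basis ι k H} {c : ι → ι → H} (hc : IsComatrix e c)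
    {τ : H ⊗[k] H →ₗ[k] R} (hτ : WithConv.toConv τ * WithConv.toConv S.σ = 1)
    {f : H →ₗ[k] k} (hf : ∀ p q, ∑ r, f (c r q) • c p r = f (c p q) • (1 : H))
    (ht : ∀ x, f ((∑ i, c i i) * x) = counit (R := k) x) (a : CrossedProduct S) :
    ∑ i, ∑ j, cleftInv S τ c i j * mk S (evalRight S f (mk S 1 (c j i) * a)) 1 = a := by
  conv_rhs => rw [← counit_coaction hc a]
  simp only [evalRight_eq_coaction hc hf, coaction_mul hc, coaction_mk hc.isMultiplicative]
  induction coaction S a with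
  | zero => simp
  | add x y hx hy => simp only [mul_add, map_add, Finset.sum_add_distrib, hx, hy]
  | tmul b g =>
    simp only [Finset.sum_mul, Algebra.TensorProduct.tmul_mul_tmul, map_sum, LinearMap.lTensor_tmul,
      TensorProduct.rid_tmul, ← ht, Finset.sum_smul, Finset.mul_sum, mul_smul_comm]
    refine Finset.sum_congr rfl fun i _ => ?_
    rw [Finset.sum_comm]
    simp only [← mul_assoc, ← Finset.smul_sum, ← Finset.sum_mul, sum_cleftInv_mul hc hτ]
    simp

/-- The mirror computation: `a₀ γ⁻¹(t₂) γ(t₃) f(a₁ S(t₁)) = a₀ f(a₁ S(t))`, since `ρ(γ⁻¹(h)) =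
γ⁻¹(h₂) ⊗ S(h₁)`. -/
theorem sum_evalRight_mul_mk {e : Module.Basis ι k H} {c : ι → ι → H} (hc : IsComatrix e c)
    {τ : H ⊗[k] H →ₗ[k] R} (hτ : WithConv.toConv τ * WithConv.toConv S.σ = 1)
    {f : H →ₗ[k] k} (hf : ∀ p q, ∑ r, f (c r q) • c p r = f (c p q) • (1 : H))
    (ht : ∀ x, f (x * antipode k (∑ i, c i i)) = counit (R := k) x) (a : CrossedProduct S) :
    ∑ i, ∑ j, mk S (evalRight S f (a * cleftInv S τ c i j)) 1 * mk S 1 (c j i) = a := by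
  conv_rhs => rw [← counit_coaction hc a]
  simp only [evalRight_eq_coaction hc hf, coaction_mul hc, coaction_cleftInv hc]
  induction coaction S a with
  | zero => simp
  | add x y hx hy => simp only [add_mul, map_add, Finset.sum_add_distrib, hx, hy]
  | tmul b g =>
    simp only [Finset.mul_sum, Algebra.TensorProduct.tmul_mul_tmul, map_sum, LinearMap.lTensor_tmul,
      TensorProduct.rid_tmul, ← ht, Finset.sum_smul, Finset.sum_mul, smul_mul_assoc]
    refine Finset.sum_congr rfl fun i _ => ?_
    rw [Finset.sum_comm]
    simp only [mul_assoc, ← Finset.smul_sum, ← Finset.mul_sum, sum_cleftInv_mul hc hτ]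
    simp

theorem exists_splitFrobenius {H : Type v} [Ring H] [HopfAlgebra k H] [FiniteDimensional k H]
    (h : (∀ x y : H, x * y = y * x) ∨ Coalgebra.IsCocomm k H)
    (hd : (Module.finrank k H : k) ≠ 0) (S : CrossedSystem k R H) :
    ∃ (φ : R →+* CrossedProduct S) (n : Type) (_ : Fintype n), Nonempty (SplitFrobenius φ n) := by
  let e := Module.finBasis k H
  obtain ⟨c, hc⟩ := IsComatrix.exists e
  obtain ⟨τ, hτ⟩ : ∃ τ : H ⊗[k] H →ₗ[k] R, WithConv.toConv τ * WithConv.toConv S.σ = 1 := by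
    obtain ⟨u, hu⟩ := S.isUnit_σ
    exact ⟨(↑u⁻¹ : WithConv (H ⊗[k] H →ₗ[k] R)).ofConv, by rw [← hu]; exact u.inv_mul⟩
  -- Dividing by the dimension achieves both `f(1) = 1`, which splits the extension, and `f(t) = 1`,
  -- which makes the bases dual.
  let f : H →ₗ[k] k := (Module.finrank k H : k)⁻¹ • regularTrace k H
  have hf (p q) : ∑ r, f (c r q) • c p r = f (c p q) • (1 : H) := by
    simp only [f, LinearMap.smul_apply, smul_assoc, ← Finset.smul_sum, hc.sum_regularTrace_smul h]
  have ht : f (∑ i, c i i) = 1 := by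
    simp only [f, LinearMap.smul_apply, hc.regularTrace_sum_diag h, smul_eq_mul]
    exact inv_mul_cancel₀ hd
  have ht1 (x : H) : f ((∑ i, c i i) * x) = counit (R := k) x := by
    rw [hc.sum_diag_mul h, map_smul, ht, smul_eq_mul, mul_one]
  have ht2 (x : H) : f (x * antipode k (∑ i, c i i)) = counit (R := k) x := by
    rw [hc.mul_antipode_sum_diag h, map_smul, hc.antipode_sum_diag h hd, ht, smul_eq_mul, mul_one]
  refine ⟨{ toFun := fun a => mk S a 1
            map_one' := rfl
            map_mul' := fun a b => (one_mk_mul hc a b 1).symm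
            map_zero' := by simp
            map_add' := by simp }, _ × _, inferInstance, ⟨{
      π := (evalRight S f).toAddMonoidHom
      π_mul_left := evalRight_one_mk_mul hc f
      π_mul_right := evalRight_mul_mk_one hc hf
      π_one := ?_
      x := fun z => cleftInv S τ c z.1 z.2
      y := fun z => mk S 1 (c z.2 z.1)
      sum_left := fun a => ?_
      sum_right := fun a => ?_
      w := algebraMap k _ (Module.finrank k H : k)⁻¹
      w_comm := fun a => (Algebra.commutes _ a).symm
      sum_mul_w := ?_ }⟩⟩
  · change evalRight S f (mk S 1 1) = 1
    rw [evalRight_mk]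
    simp only [f, LinearMap.smul_apply, regularTrace_one, smul_eq_mul, inv_mul_cancel₀ hd, one_smul]
  · rw [Fintype.sum_prod_type]
    exact sum_cleftInv_mul_evalRight hc hτ hf ht1 a
  · rw [Fintype.sum_prod_type]
    exact sum_evalRight_mul_mk hc hτ hf ht2 a
  · rw [Fintype.sum_prod_type]
    simp only [sum_cleftInv_mul hc hτ, if_true, Finset.sum_const, Finset.card_univ,
      Fintype.card_fin]
    rw [nsmul_eq_mul, mul_one, ← map_natCast (algebraMap k (CrossedProduct S)), ← map_mul,
      mul_inv_cancel₀ hd, map_one]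

end CrossedProduct

end CrossedProducts

/-! ### Frobenius structure of the skew group ring -/

section SkewMonoidAlgebra

open SkewMonoidAlgebra in
theorem SkewMonoidAlgebra.exists_splitFrobenius {R : Type*} {G : Type v} [Ring R] [Group G] [Finite G]
    [MulSemiringAction G R] (h : IsUnit (Nat.card G : R)) :
    ∃ (φ : R →+* SkewMonoidAlgebra R G) (n : Type v) (_ : Fintype n),
      Nonempty (SplitFrobenius φ n) := by
  classical
  have := Fintype.ofFinite G
  obtain ⟨u, hu⟩ := h
  let φ : R →+* SkewMonoidAlgebra R G :=
    { toFun := single 1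
      map_one' := rfl
      map_mul' := fun a b => by simp [single_mul_single]
      map_zero' := by simp
      map_add' := by simp }
  -- The coefficient at the identity, with dual bases `g` and `g⁻¹`; then `∑ g g⁻¹ = |G|`.
  let π : SkewMonoidAlgebra R G →+ R :=
    { toFun := fun f => f.coeff 1
      map_zero' := by simp
      map_add' := by simp }
  have hφ (r : R) : φ r = single 1 r := rfl
  have hπ (f : SkewMonoidAlgebra R G) : π f = f.coeff 1 := rfl
  have hw : ((Units.map (φ : R →* SkewMonoidAlgebra R G) u : (SkewMonoidAlgebra R G)ˣ) :
      SkewMonoidAlgebra R G) = (Nat.card G : SkewMonoidAlgebra R G) := by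
    simp [hu]
  refine ⟨φ, G, inferInstance, ⟨{
    π := π
    π_mul_left := fun r a => by simp [hφ, hπ]
    π_mul_right := fun a r => by simp [hφ, hπ]
    π_one := by simp [hπ]
    x := fun g => single g 1
    y := fun g => single g⁻¹ 1
    sum_left := fun a => ?_
    sum_right := fun a => ?_
    w := ↑(Units.map (φ : R →* SkewMonoidAlgebra R G) u)⁻¹
    w_comm := fun a => (Commute.units_inv_right (by rw [hw]; exact Nat.commute_cast a _)).eq
    sum_mul_w := ?_ }⟩⟩
  · induction a using SkewMonoidAlgebra.induction_on with
    | zero => simp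
    | single h r =>
      rw [Finset.sum_eq_single h]
      · simp [hφ, hπ, single_mul_single]
      · intro g _ hg
        simp [hφ, hπ, single_mul_single, inv_mul_eq_one, hg]
      · simp
    | add f g hf hg => simp only [mul_add, map_add, Finset.sum_add_distrib, hf, hg]
  · induction a using SkewMonoidAlgebra.induction_on with
    | zero => simp
    | single h r =>
      rw [Finset.sum_eq_single h⁻¹]
      · simp [hφ, hπ, single_mul_single]
      · intro g _ hg
        have : h * g ≠ 1 := fun h1 => hg (eq_inv_of_mul_eq_one_right h1)
        simp [hφ, hπ, single_mul_single, this]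
      · simp
    | add f g hf hg => simp only [add_mul, map_add, Finset.sum_add_distrib, hf, hg]
  · have : ∑ g : G, (single g 1 * single g⁻¹ 1 : SkewMonoidAlgebra R G)
        = ↑(Units.map (φ : R →* SkewMonoidAlgebra R G) u) := by
      simp [single_mul_single, hw]
    rw [this, Units.mul_inv]

end SkewMonoidAlgebra

/-! ### Averaging and projective modules -/

section SplitFrobeniusModules

open MulOpposite

namespace SplitFrobenius

variable {R A : Type*} [Ring R] [Ring A] {φ : R →+* A} {ι : Type*} [Fintype ι]

/-- The opposite extension. -/
def op (F : SplitFrobenius φ ι) : SplitFrobenius φ.op ι where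
  π := AddMonoidHom.mk' (fun a => MulOpposite.op (F.π a.unop)) (by simp)
  π_mul_left r a := unop_injective (by simp [F.π_mul_right])
  π_mul_right a r := unop_injective (by simp [F.π_mul_left])
  π_one := unop_injective (by simp [F.π_one])
  x i := MulOpposite.op (F.y i)
  y i := MulOpposite.op (F.x i)
  sum_left a := unop_injective (by simpa [Finset.unop_sum] using F.sum_right a.unop)
  sum_right a := unop_injective (by simpa [Finset.unop_sum] using F.sum_left a.unop)
  w := MulOpposite.op F.w
  w_comm a := unop_injective (by simp [F.w_comm])
  sum_mul_w := unop_injective (by simpa [Finset.unop_sum, ← F.w_comm] using F.sum_mul_w)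

variable (F : SplitFrobenius φ ι)
include F

theorem π_φ (r : R) : F.π (φ r) = r := by
  simpa [F.π_one] using F.π_mul_left r 1

/-- The Casimir element `∑ x i ⊗ y i` commutes with `A`. Expand `y i * a` in the dual basis, move
the coefficients in `R` across, and resum. -/
theorem sum_smul_apply_mul {E : Type*} [AddCommGroup E] [Module A E] (q : A →+ E)
    (hq : ∀ r a, q (φ r * a) = φ r • q a) (a : A) :
    ∑ i, F.x i • q (F.y i * a) = a • ∑ i, F.x i • q (F.y i) := by
  calc _ = ∑ i, F.x i • q (∑ j, φ (F.π (F.y i * a * F.x j)) * F.y j) := by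
        simp only [F.sum_right]
    _ = ∑ j, (∑ i, F.x i * φ (F.π (F.y i * (a * F.x j)))) • q (F.y j) := by
        simp only [map_sum, hq, Finset.smul_sum, Finset.sum_smul, smul_smul, mul_assoc]
        rw [Finset.sum_comm]
    _ = _ := by simp only [F.sum_left, Finset.smul_sum, smul_smul]

section Average

variable {M N : Type*} [AddCommGroup M] [Module A M] [Module R M] [AddCommGroup N] [Module A N]
  [Module R N]

/-- The average `n ↦ ∑ w xᵢ p (yᵢ n)` of an `R`-linear map is `A`-linear. -/
def average (hM : ∀ (r : R) (m : M), r • m = φ r • m) (hN : ∀ (r : R) (n : N), r • n = φ r • n)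
    (p : N →ₗ[R] M) : N →ₗ[A] M where
  toFun n := F.w • ∑ i, F.x i • p (F.y i • n)
  map_add' m n := by simp [Finset.sum_add_distrib]
  map_smul' a n := by
    have := F.sum_smul_apply_mul (AddMonoidHom.mk' (fun a => p (a • n)) (by simp [add_smul]))
      (fun r a => by simp [mul_smul, ← hN, ← hM]) a
    simp only [AddMonoidHom.mk'_apply, mul_smul] at this
    rw [this, RingHom.id_apply, smul_smul, smul_smul, F.w_comm]

variable (hM : ∀ (r : R) (m : M), r • m = φ r • m) (hN : ∀ (r : R) (n : N), r • n = φ r • n)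

theorem average_apply (p : N →ₗ[R] M) (n : N) :
    F.average hM hN p n = F.w • ∑ i, F.x i • p (F.y i • n) := rfl

omit [Module R M] in
theorem w_smul_sum_smul (m : M) : F.w • ∑ i, F.x i • F.y i • m = m := by
  simp only [smul_smul, ← Finset.sum_smul]
  rw [← F.w_comm, F.sum_mul_w, one_smul]

theorem comp_average {L : Type*} [AddCommGroup L] [Module A L] (p : N →ₗ[R] M) (f : M →ₗ[A] L)
    (g : N →ₗ[A] L) (h : ∀ n, f (p n) = g n) (n : N) : f (F.average hM hN p n) = g n := by
  simp only [average_apply, map_smul, map_sum, h, F.w_smul_sum_smul]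

theorem average_comp {L : Type*} [AddCommGroup L] [Module A L] (p : N →ₗ[R] M) (f : L →ₗ[A] N)
    (g : L →ₗ[A] M) (h : ∀ n, p (f n) = g n) (n : L) : F.average hM hN p (f n) = g n := by
  simp only [average_apply, ← map_smul f, h]
  simp only [map_smul, F.w_smul_sum_smul]

end Average

section Projective

variable {M : Type*} [AddCommGroup M] [Module A M] [Module R M]
  (hM : ∀ (r : R) (m : M), r • m = φ r • m)
include hM

/-- An `R`-linear section of a free `A`-cover averages to an `A`-linear section. -/
theorem projective_of_projective_restrict [Module.Projective R M] : Module.Projective A M := by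
  let _ : Module R (M →₀ A) := Module.compHom _ φ
  let f : (M →₀ A) →ₗ[A] M := Finsupp.linearCombination A id
  let f' : (M →₀ A) →ₗ[R] M :=
    { f with map_smul' := fun r x => (f.map_smul (φ r) x).trans (hM r _).symm }
  obtain ⟨s, hs⟩ := Module.projective_lifting_property f' LinearMap.id
    (fun m => ⟨Finsupp.single m 1, by simp [f', f]⟩)
  exact Module.Projective.of_split (F.average (fun _ _ => rfl) hM s) f
    (LinearMap.ext fun m => F.comp_average (fun _ _ => rfl) hM s f LinearMap.id
      (fun n => LinearMap.congr_fun hs n) m)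

omit hM in
/-- `A` as a direct summand of a free `R`-module. -/
theorem exists_retract_self [Module R A] (hA : ∀ (r : R) (a : A), r • a = φ r * a) :
    ∃ (i : A →ₗ[R] (ι → R)) (s : (ι → R) →ₗ[R] A), s ∘ₗ i = LinearMap.id := by
  refine ⟨{ toFun := fun a i => F.π (a * F.x i)
            map_add' := fun a b => by ext; simp [add_mul]
            map_smul' := fun r a => by ext; simp [hA, mul_assoc, F.π_mul_left] },
    { toFun := fun c => ∑ i, φ (c i) * F.y i
      map_add' := fun a b => by simp [add_mul, Finset.sum_add_distrib]
      map_smul' := fun r a => by simp [hA, mul_assoc, Finset.mul_sum] }, ?_⟩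
  ext a
  exact F.sum_right a

omit hM in
theorem projective_self [Module R A] (hA : ∀ (r : R) (a : A), r • a = φ r * a) :
    Module.Projective R A := by
  obtain ⟨i, s, h⟩ := F.exists_retract_self hA
  exact Module.Projective.of_split i s h

/-- Free `A`-modules are `R`-projective because `A` is, and an `A`-splitting is also an
`R`-splitting. -/
theorem projective_restrict_of_projective [Module.Projective A M] : Module.Projective R M := by
  let _ : Module R A := Module.compHom _ φ
  have := F.projective_self (fun _ _ => rfl)
  obtain ⟨s, hs⟩ := Module.projective_def'.mp ‹Module.Projective A M›
  have : Module.Projective R (M →₀ A) := by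
    classical
    exact Module.Projective.of_equiv' (finsuppLequivDFinsupp (ι := M) (M := A) R).symm
  let f : (M →₀ A) →ₗ[A] M := Finsupp.linearCombination A id
  let s' : M →ₗ[R] M →₀ A :=
    { s with map_smul' := fun r x => (congrArg s (hM r x)).trans (s.map_smul (φ r) x) }
  let f' : (M →₀ A) →ₗ[R] M :=
    { f with map_smul' := fun r x => (f.map_smul (φ r) x).trans (hM r _).symm }
  exact Module.Projective.of_split s' f' (LinearMap.ext fun m => LinearMap.congr_fun hs m)

theorem projective_restrict_iff : Module.Projective R M ↔ Module.Projective A M :=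
  ⟨fun _ => F.projective_of_projective_restrict hM, fun _ => F.projective_restrict_of_projective hM⟩

end Projective

end SplitFrobenius

/-! ### Coinduced modules -/

section Coind

/-- The coinduced module of all `R`-linear maps `A → N`. -/
def Coind {R A : Type*} [Ring R] [Ring A] (φ : R →+* A) (N : Type*) [AddCommGroup N]
    [Module R N] : AddSubgroup (A →+ N) where
  carrier := {f | ∀ r a, f (φ r * a) = r • f a}
  zero_mem' := by simp
  add_mem' hf hg := fun r a => by
    rw [AddMonoidHom.add_apply, hf r a, hg r a, AddMonoidHom.add_apply, smul_add]
  neg_mem' hf := fun r a => by rw [AddMonoidHom.neg_apply, hf r a, AddMonoidHom.neg_apply, smul_neg]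

namespace Coind

variable {R A : Type*} [Ring R] [Ring A] {φ : R →+* A} {N : Type*} [AddCommGroup N] [Module R N]

instance : Module A (Coind φ N) where
  smul a f := ⟨f.1.comp (AddMonoidHom.mulRight a), fun r b => by
    simpa [mul_assoc] using f.2 r (b * a)⟩
  one_smul f := Subtype.ext (AddMonoidHom.ext fun b => congrArg f.1 (mul_one b))
  mul_smul a b f := Subtype.ext (AddMonoidHom.ext fun c => congrArg f.1 (mul_assoc c a b).symm)
  smul_zero a := rfl
  smul_add a f g := rfl
  add_smul a b f := Subtype.ext (AddMonoidHom.ext fun c =>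
    (congrArg f.1 (mul_add c a b)).trans (map_add _ _ _))
  zero_smul f := Subtype.ext (AddMonoidHom.ext fun c =>
    (congrArg f.1 (mul_zero c)).trans (map_zero _))

theorem smul_val_apply (a b : A) (f : Coind φ N) : (a • f).1 b = f.1 (b * a) := rfl

/-- Coinduction on maps. -/
def map {N' : Type*} [AddCommGroup N'] [Module R N'] (g : N →ₗ[R] N') :
    Coind φ N →ₗ[A] Coind φ N' where
  toFun f := ⟨g.toAddMonoidHom.comp f.1, fun r a => by
    simpa using congrArg g (f.2 r a)⟩
  map_add' f f' := Subtype.ext (AddMonoidHom.ext fun a => map_add g _ _)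
  map_smul' a f := rfl

theorem map_injective {N' : Type*} [AddCommGroup N'] [Module R N'] {g : N →ₗ[R] N'}
    (hg : Function.Injective g) : Function.Injective (map (φ := φ) g) := fun _ _ h =>
  Subtype.ext (AddMonoidHom.ext fun a => hg (DFunLike.congr_fun (congrArg Subtype.val h) a))

end Coind

namespace SplitFrobenius

variable {R A : Type*} [Ring R] [Ring A] {φ : R →+* A} {ι : Type*} [Fintype ι]
  (F : SplitFrobenius φ ι) {N : Type*} [AddCommGroup N] [Module R N]
include F

/-- The map `n ↦ (a ↦ π a • n)` into the coinduced module. -/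
def coindUnit [Module R (Coind φ N)] (hC : ∀ (r : R) (f : Coind φ N), r • f = φ r • f) :
    N →ₗ[R] Coind φ N where
  toFun n := ⟨AddMonoidHom.mk' (fun a => F.π a • n) (by simp [add_smul]), fun r a => by
    simp [F.π_mul_left, mul_smul]⟩
  map_add' m n := Subtype.ext (AddMonoidHom.ext fun a => smul_add _ _ _)
  map_smul' r n := Subtype.ext (AddMonoidHom.ext fun a => by
    rw [RingHom.id_apply, hC, Coind.smul_val_apply]
    simp [F.π_mul_right, mul_smul])

omit F in
/-- Evaluation at `1`. -/
def coindEval [Module R (Coind φ N)] (hC : ∀ (r : R) (f : Coind φ N), r • f = φ r • f) :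
    Coind φ N →ₗ[R] N where
  toFun f := f.1 1
  map_add' f g := rfl
  map_smul' r f := by
    rw [RingHom.id_apply, hC, Coind.smul_val_apply, one_mul, ← f.2 r 1, mul_one]

/-- This uses `π 1 = 1`. It makes every `R`-module a retract of a restricted `A`-module. -/
theorem coindEval_comp_coindUnit [Module R (Coind φ N)]
    (hC : ∀ (r : R) (f : Coind φ N), r • f = φ r • f) :
    coindEval hC ∘ₗ F.coindUnit hC = (LinearMap.id : N →ₗ[R] N) :=
  LinearMap.ext fun n => by
    change F.π 1 • n = n
    rw [F.π_one, one_smul]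

/-- The `A`-linear extension of an `R`-linear map along the unit of coinduction. -/
def coindLift {E : Type*} [AddCommGroup E] [Module A E] [Module R E]
    (hE : ∀ (r : R) (e : E), r • e = φ r • e) (g : N →ₗ[R] E) : Coind φ N →ₗ[A] E where
  toFun f := ∑ i, F.x i • g (f.1 (F.y i))
  map_add' f f' := by simp [Finset.sum_add_distrib]
  map_smul' a f := by
    refine F.sum_smul_apply_mul (g.toAddMonoidHom.comp f.1) (fun r a => ?_) a
    rw [← hE]
    simpa using congrArg g (f.2 r a)

/-- For a Frobenius extension coinduction is also left adjoint to restriction. This is the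
factorisation through the unit, from `∑ x i * φ (π (y i)) = 1`. -/
theorem coindLift_coindUnit [Module R (Coind φ N)]
    (hC : ∀ (r : R) (f : Coind φ N), r • f = φ r • f) {E : Type*} [AddCommGroup E] [Module A E]
    [Module R E] (hE : ∀ (r : R) (e : E), r • e = φ r • e) (g : N →ₗ[R] E) (n : N) :
    F.coindLift hE g (F.coindUnit hC n) = g n := by
  change ∑ i, F.x i • g (F.π (F.y i) • n) = g n
  have := F.sum_left 1
  simp only [mul_one] at this
  simp only [map_smul, hE, smul_smul, ← Finset.sum_smul, this, one_smul]

end SplitFrobenius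

end Coind

/-! ### Injective modules under restriction -/

section Injective

namespace SplitFrobenius

variable {R : Type*} {A : Type v} [Ring R] [Ring A] {φ : R →+* A} {ι : Type*} [Fintype ι]
  (F : SplitFrobenius φ ι)
include F

theorem injective_of_injective_restrict {E : Type*} [AddCommGroup E] [Module A E] [Module R E]
    (hE : ∀ (r : R) (e : E), r • e = φ r • e) [Module.Injective R E] : Module.Injective A E := by
  refine ⟨fun X Y _ _ _ _ f hf g => ?_⟩
  let _ : Module R X := Module.compHom _ φ
  let _ : Module R Y := Module.compHom _ φ
  obtain ⟨p, hp⟩ := Module.Injective.out (R := R) (Q := E)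
    ({ f with map_smul' := fun r x => f.map_smul (φ r) x } : X →ₗ[R] Y) hf
    { g with map_smul' := fun r x => (g.map_smul (φ r) x).trans (hE r _).symm }
  exact ⟨F.average hE (fun _ _ => rfl) p, fun x =>
    F.average_comp hE (fun _ _ => rfl) p f g hp x⟩

/-- Restriction has a left adjoint, coinduction, that preserves injections. So `g` is transposed,
extended over `A`, and pulled back along the unit. -/
theorem injective_restrict_of_injective {E : Type v} [AddCommGroup E] [Module A E] [Module R E]
    (hE : ∀ (r : R) (e : E), r • e = φ r • e) [Module.Injective A E] : Module.Injective R E := by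
  refine ⟨fun X Y _ _ _ _ f hf g => ?_⟩
  let _ : Module R (Coind φ X) := Module.compHom _ φ
  let _ : Module R (Coind φ Y) := Module.compHom _ φ
  obtain ⟨p, hp⟩ := Module.Injective.out (R := A) (Q := E) (Coind.map (φ := φ) f)
    (Coind.map_injective hf) (F.coindLift hE g)
  refine ⟨{ toFun := fun y => p (F.coindUnit (fun _ _ => rfl) y)
            map_add' := by simp
            map_smul' := fun r y => ?_ }, fun x => ?_⟩
  · rw [RingHom.id_apply, hE, ← map_smul p, (F.coindUnit (fun _ _ => rfl)).map_smul]
    rfl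
  · change p (F.coindUnit (fun _ _ => rfl) (f x)) = g x
    rw [← F.coindLift_coindUnit (fun _ _ => rfl) hE g x, ← hp]
    congr 1
    exact Subtype.ext (AddMonoidHom.ext fun a => (f.map_smul _ _).symm)

end SplitFrobenius

end Injective

end SplitFrobeniusModules

/-! ### Projective, injective and global dimensions -/

section HomologicalDimension

open CategoryTheory

theorem hasProjectiveDimensionLT_add_two_iff {R : Type u} [Ring R] [Small.{w} R]
    {M₁ M₂ M₃ : Type w} [AddCommGroup M₁] [AddCommGroup M₂] [AddCommGroup M₃] [Module R M₁]
    [Module R M₂] [Module R M₃] [Module.Projective R M₂] (f : M₁ →ₗ[R] M₂) (g : M₂ →ₗ[R] M₃)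
    (hf : Function.Injective f) (hfg : Function.Exact f g) (hg : Function.Surjective g) (n : ℕ) :
    HasProjectiveDimensionLT (ModuleCat.of R M₃) (n + 2)
      ↔ HasProjectiveDimensionLT (ModuleCat.of R M₁) (n + 1) :=
  (ModuleCat.shortComplex_shortExact (ModuleCat.shortComplexOfCompEqZero f g
    hfg.linearMap_comp_eq_zero) hfg hf hg).hasProjectiveDimensionLT_X₃_iff n
    ((IsProjective.iff_projective M₂).mp ‹_›)

theorem hasInjectiveDimensionLT_add_two_iff {R : Type u} [Ring R] [Small.{w} R]
    {M₁ M₂ M₃ : Type w} [AddCommGroup M₁] [AddCommGroup M₂] [AddCommGroup M₃] [Module R M₁]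
    [Module R M₂] [Module R M₃] [Module.Injective R M₂] (f : M₁ →ₗ[R] M₂) (g : M₂ →ₗ[R] M₃)
    (hf : Function.Injective f) (hfg : Function.Exact f g) (hg : Function.Surjective g) (n : ℕ) :
    HasInjectiveDimensionLT (ModuleCat.of R M₁) (n + 2)
      ↔ HasInjectiveDimensionLT (ModuleCat.of R M₃) (n + 1) :=
  ((ModuleCat.shortComplex_shortExact (ModuleCat.shortComplexOfCompEqZero f g
    hfg.linearMap_comp_eq_zero) hfg hf hg).hasInjectiveDimensionLT_X₃_iff n
    (Module.injective_object_of_injective_module R M₂)).symm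

namespace SplitFrobenius

/-- Dimension shifting along a free `A`-cover, which stays projective over `R`. The bounds `0` and
`1` mean zero and projective modules, so shifting starts at `n + 2`. -/
theorem hasProjectiveDimensionLT_restrict_iff {R : Type u} {A : Type v} [Ring R] [Ring A]
    [Small.{v} R] {φ : R →+* A} {ι : Type*} [Fintype ι] (F : SplitFrobenius φ ι) (n : ℕ)
    (M : Type v) [AddCommGroup M] [Module A M] [Module R M]
    (hM : ∀ (r : R) (m : M), r • m = φ r • m) :
    HasProjectiveDimensionLT (ModuleCat.of R M) n
      ↔ HasProjectiveDimensionLT (ModuleCat.of A M) n := by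
  induction n generalizing M with
  | zero => simp only [hasProjectiveDimensionLT_zero_iff_isZero, ModuleCat.isZero_of_iff_subsingleton]
  | succ n ih =>
    cases n with
    | zero =>
      simp only [zero_add, ← projective_iff_hasProjectiveDimensionLT_one,
        ← IsProjective.iff_projective]
      exact F.projective_restrict_iff hM
    | succ n =>
      let f : (M →₀ A) →ₗ[A] M := Finsupp.linearCombination A id
      have hf : Function.Surjective f := fun m => ⟨Finsupp.single m 1, by simp [f]⟩
      have hexact : Function.Exact (LinearMap.ker f).subtype f := fun _ => by simp
      have key := hasProjectiveDimensionLT_add_two_iff (M₁ := LinearMap.ker f) (LinearMap.ker f).subtype f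
        Subtype.val_injective hexact hf n
      let _ : Module R (M →₀ A) := Module.compHom _ φ
      let _ : Module R (LinearMap.ker f) := Module.compHom _ φ
      have : Module.Projective R (M →₀ A) := F.projective_restrict_of_projective fun _ _ => rfl
      rw [key, ← ih _ fun _ _ => rfl]
      exact hasProjectiveDimensionLT_add_two_iff
        ({ (LinearMap.ker f).subtype with map_smul' := fun r x => rfl } :
          LinearMap.ker f →ₗ[R] M →₀ A)
        ({ f with map_smul' := fun r x => (f.map_smul (φ r) x).trans (hM r _).symm } :
          (M →₀ A) →ₗ[R] M) Subtype.val_injective hexact hf n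

theorem hasInjectiveDimensionLT_restrict_iff {R : Type u} {A : Type v} [Ring R] [Ring A]
    [Small.{v} R] {φ : R →+* A} {ι : Type*} [Fintype ι] (F : SplitFrobenius φ ι) (n : ℕ)
    (M : Type v) [AddCommGroup M] [Module A M] [Module R M]
    (hM : ∀ (r : R) (m : M), r • m = φ r • m) :
    HasInjectiveDimensionLT (ModuleCat.of R M) n
      ↔ HasInjectiveDimensionLT (ModuleCat.of A M) n := by
  induction n generalizing M with
  | zero => simp only [hasInjectiveDimensionLT_zero_iff_isZero, ModuleCat.isZero_of_iff_subsingleton]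
  | succ n ih =>
    cases n with
    | zero =>
      simp only [zero_add, ← injective_iff_hasInjectiveDimensionLT_one,
        ← Module.injective_iff_injective_object]
      exact ⟨fun _ => F.injective_of_injective_restrict hM,
        fun _ => F.injective_restrict_of_injective hM⟩
    | succ n =>
      -- Dually, embed in an injective `A`-module, which stays injective over `R`, and pass to the
      -- cokernel.
      let J := Injective.under (ModuleCat.of A M)
      let f : M →ₗ[A] J := (Injective.ι (ModuleCat.of A M)).hom
      have hf : Function.Injective f := (ModuleCat.mono_iff_injective _).mp inferInstance
      have : Module.Injective A J := by
        have : Injective (ModuleCat.of A J) := inferInstanceAs (Injective J)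
        exact Module.injective_module_of_injective_object A J
      have hg : Function.Surjective (LinearMap.range f).mkQ := Submodule.mkQ_surjective _
      have hexact : Function.Exact f (LinearMap.range f).mkQ := fun x => by simp
      let _ : Module R J := Module.compHom _ φ
      let _ : Module R (J ⧸ LinearMap.range f) := Module.compHom _ φ
      have : Module.Injective R J := F.injective_restrict_of_injective fun _ _ => rfl
      rw [hasInjectiveDimensionLT_add_two_iff (R := A) f (LinearMap.range f).mkQ hf hexact hg,
        ← ih _ fun _ _ => rfl]
      exact hasInjectiveDimensionLT_add_two_iff
        ({ f with map_smul' := fun r x => (congrArg f (hM r x)).trans (f.map_smul (φ r) x) } :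
          M →ₗ[R] J)
        ({ (LinearMap.range f).mkQ with map_smul' := fun r x => rfl } :
          J →ₗ[R] J ⧸ LinearMap.range f) hf hexact hg n

theorem projectiveDimension_restrict {R : Type u} {A : Type v} [Ring R] [Ring A]
    [Small.{v} R] {φ : R →+* A} {ι : Type*} [Fintype ι] (F : SplitFrobenius φ ι)
    (M : Type v) [AddCommGroup M] [Module A M] [Module R M]
    (hM : ∀ (r : R) (m : M), r • m = φ r • m) :
    projectiveDimension (ModuleCat.of R M) = projectiveDimension (ModuleCat.of A M) := by
  simp only [projectiveDimension, F.hasProjectiveDimensionLT_restrict_iff _ M hM]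

/-- One inequality comes from retracts of coinduced modules, the other from restricting `A`-modules.
-/
theorem leftGlobalDim_eq {R : Type u} {A : Type (max u v)} [Ring R] [Ring A]
    {φ : R →+* A} {ι : Type*} [Fintype ι] (F : SplitFrobenius φ ι) :
    leftGlobalDim.{u, v} R = leftGlobalDim.{max u v, v} A := by
  refine le_antisymm (iSup_le fun N => ?_) (iSup_le fun M => ?_)
  · let _ : Module R (Coind φ N) := Module.compHom _ φ
    let r : Retract N (ModuleCat.of R (Coind φ N)) :=
      { i := ModuleCat.ofHom (F.coindUnit fun _ _ => rfl)
        r := ModuleCat.ofHom (coindEval fun _ _ => rfl)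
        retract := ModuleCat.hom_ext (F.coindEval_comp_coindUnit fun _ _ => rfl) }
    refine r.projectiveDimension_le.trans ?_
    rw [F.projectiveDimension_restrict _ fun _ _ => rfl]
    exact le_iSup (fun M : ModuleCat.{max u v} A => projectiveDimension M)
      (ModuleCat.of A (Coind φ N))
  · let _ : Module R M := Module.compHom _ φ
    change projectiveDimension (ModuleCat.of A M) ≤ _
    rw [← F.projectiveDimension_restrict M fun _ _ => rfl]
    exact le_iSup (fun M : ModuleCat.{max u v} R => projectiveDimension M) (ModuleCat.of R M)

theorem rightGlobalDim_eq {R : Type u} {A : Type (max u v)} [Ring R] [Ring A]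
    {φ : R →+* A} {ι : Type*} [Fintype ι] (F : SplitFrobenius φ ι) :
    rightGlobalDim.{u, v} R = rightGlobalDim.{max u v, v} A :=
  F.op.leftGlobalDim_eq

end SplitFrobenius

end HomologicalDimension

/-! ### Character modules and weak dimension -/

section WeakDimension

open CategoryTheory

/-- The character module `Hom_ℤ(N, ℚ/ℤ)` of a left module, as a right module. -/
def CharacterDual (N : Type*) [AddCommGroup N] : Type _ := N →+ AddCircle (1 : ℚ)

namespace CharacterDual

variable {N : Type*} [AddCommGroup N]

instance : AddCommGroup (CharacterDual N) := inferInstanceAs (AddCommGroup (N →+ AddCircle (1 : ℚ)))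

instance : FunLike (CharacterDual N) N (AddCircle (1 : ℚ)) :=
  inferInstanceAs (FunLike (N →+ AddCircle (1 : ℚ)) N (AddCircle (1 : ℚ)))

instance : AddMonoidHomClass (CharacterDual N) N (AddCircle (1 : ℚ)) :=
  inferInstanceAs (AddMonoidHomClass (N →+ AddCircle (1 : ℚ)) N (AddCircle (1 : ℚ)))

@[ext]
theorem ext {f g : CharacterDual N} (h : ∀ n, f n = g n) : f = g := DFunLike.ext _ _ h

variable {R : Type*} [Ring R] [Module R N]

instance : Module Rᵐᵒᵖ (CharacterDual N) where
  smul r f := AddMonoidHom.comp f (DistribSMul.toAddMonoidHom N r.unop)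
  one_smul f := ext fun n => congrArg f (one_smul R n)
  mul_smul r s f := ext fun n => congrArg f (mul_smul s.unop r.unop n)
  smul_zero _ := rfl
  smul_add _ _ _ := rfl
  add_smul r s f := ext fun n => (congrArg f (add_smul r.unop s.unop n)).trans (map_add f _ _)
  zero_smul f := ext fun n => (congrArg f (zero_smul R n)).trans (map_zero f)

theorem smul_apply (r : Rᵐᵒᵖ) (f : CharacterDual N) (n : N) : (r • f) n = f (r.unop • n) := rfl

theorem add_apply (f g : CharacterDual N) (n : N) : (f + g) n = f n + g n := rfl

/-- The map of character modules induced by a linear map. -/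
def map {N' : Type*} [AddCommGroup N'] [Module R N'] (f : N →ₗ[R] N') :
    CharacterDual N' →ₗ[Rᵐᵒᵖ] CharacterDual N where
  toFun χ := AddMonoidHom.comp χ f.toAddMonoidHom
  map_add' _ _ := rfl
  map_smul' r χ := ext fun n => congrArg χ (f.map_smul r.unop n).symm

theorem map_apply {N' : Type*} [AddCommGroup N'] [Module R N'] (f : N →ₗ[R] N')
    (χ : CharacterDual N') (n : N) : map f χ n = χ (f n) := rfl

theorem map_injective {N' : Type*} [AddCommGroup N'] [Module R N'] {f : N →ₗ[R] N'}
    (hf : Function.Surjective f) : Function.Injective (map f) := fun χ ψ h => ext fun n => by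
  obtain ⟨m, rfl⟩ := hf n
  exact DFunLike.congr_fun h m

theorem exists_extension {M M' : Type*} [AddCommGroup M] [AddCommGroup M'] (f : M →+ M')
    (hf : Function.Injective f) (χ : M →+ AddCircle (1 : ℚ)) :
    ∃ ψ : M' →+ AddCircle (1 : ℚ), ∀ m, ψ (f m) = χ m := by
  obtain ⟨ψ, hψ⟩ := CharacterModule.dual_surjective_of_injective f.toIntLinearMap hf χ
  exact ⟨ψ, fun m => DFunLike.congr_fun hψ m⟩

theorem map_surjective {N' : Type*} [AddCommGroup N'] [Module R N'] {f : N →ₗ[R] N'}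
    (hf : Function.Injective f) : Function.Surjective (map f) := fun χ => by
  obtain ⟨ψ, hψ⟩ := exists_extension f.toAddMonoidHom hf χ
  exact ⟨ψ, ext hψ⟩

theorem map_exact_ker {N' : Type*} [AddCommGroup N'] [Module R N'] {f : N →ₗ[R] N'}
    (hf : Function.Surjective f) : Function.Exact (map f) (map (LinearMap.ker f).subtype) := by
  intro χ
  refine ⟨fun h => ?_, ?_⟩
  · have hker : f.toAddMonoidHom.ker ≤ AddMonoidHom.ker (χ : N →+ AddCircle (1 : ℚ)) :=
      fun n hn => AddMonoidHom.mem_ker.mpr (DFunLike.congr_fun h ⟨n, hn⟩)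
    refine ⟨f.toAddMonoidHom.liftOfSurjective hf ⟨χ, hker⟩, ext fun n => ?_⟩
    exact AddMonoidHom.liftOfRightInverse_comp_apply _ _ (Function.rightInverse_surjInv hf)
      ⟨χ, hker⟩ n
  · rintro ⟨ψ, rfl⟩
    refine ext fun n => ?_
    rw [map_apply, map_apply, Submodule.subtype_apply, LinearMap.mem_ker.mp n.2, map_zero]
    rfl

end CharacterDual

section

variable {R : Type*} [Ring R] {M N : Type*} [AddCommGroup M] [Module Rᵐᵒᵖ M]
  [AddCommGroup N] [Module R N]

/-- The map `M → Hom(N, ℚ/ℤ)` attached to a character of `M ⊗_R N`. -/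
def BalancedTensor.curry (χ : BalancedTensor R M N →+ AddCircle (1 : ℚ)) :
    M →ₗ[Rᵐᵒᵖ] CharacterDual N where
  toFun m := (χ.comp (QuotientAddGroup.mk' (balancedRel R M N))).comp
    (TensorProduct.mk ℤ M N m).toAddMonoidHom
  map_add' m m' := CharacterDual.ext fun n =>
    (congrArg (χ.comp (QuotientAddGroup.mk' (balancedRel R M N)))
      (TensorProduct.add_tmul m m' n)).trans (map_add _ _ _)
  map_smul' r m := CharacterDual.ext fun n => congrArg χ <| by
    refine (QuotientAddGroup.eq_iff_sub_mem).mpr ?_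
    exact AddSubgroup.subset_closure ⟨m, r.unop, n, rfl⟩

/-- The character of `M ⊗_R N` attached to a map `M → Hom(N, ℚ/ℤ)`. -/
def BalancedTensor.uncurry (g : M →ₗ[Rᵐᵒᵖ] CharacterDual N) :
    BalancedTensor R M N →+ AddCircle (1 : ℚ) :=
  QuotientAddGroup.lift (balancedRel R M N)
    (TensorProduct.liftAddHom (g.toAddMonoidHom : M →+ N →+ AddCircle (1 : ℚ))
      fun r m n => by
        change g (r • m) n = g m (r • n)
        rw [map_zsmul, map_zsmul]
        rfl) (by
    rw [balancedRel, AddSubgroup.closure_le]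
    rintro _ ⟨m, r, n, rfl⟩
    rw [SetLike.mem_coe, AddMonoidHom.mem_ker, map_sub, sub_eq_zero]
    change g (MulOpposite.op r • m) n = g m (r • n)
    rw [map_smul]
    rfl)

theorem BalancedTensor.hom_ext {f g : BalancedTensor R M N →+ AddCircle (1 : ℚ)}
    (h : ∀ (m : M) (n : N), f (QuotientAddGroup.mk (m ⊗ₜ n)) = g (QuotientAddGroup.mk (m ⊗ₜ n))) :
    f = g := by
  refine QuotientAddGroup.addMonoidHom_ext _ (AddMonoidHom.ext fun t => ?_)
  induction t with
  | zero => simp only [map_zero]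
  | add x y hx hy => simp only [map_add, hx, hy]
  | tmul m n => exact h m n

end

/-- Lambek's criterion: characters of `M ⊗ N` are maps from `M` to the character module of `N`.
Characters extend along injections and separate points. -/
theorem isFlatModule_iff_injective_characterDual {R : Type u} [Ring R] {N : Type max u v}
    [AddCommGroup N] [Module R N] :
    IsFlatModule R N ↔ Module.Injective Rᵐᵒᵖ (CharacterDual N) := by
  constructor
  · intro h
    refine ⟨fun M M' _ _ _ _ f hf g => ?_⟩
    obtain ⟨ψ, hψ⟩ := CharacterDual.exists_extension (BalancedTensor.map N f) (h M M' f hf)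
      (BalancedTensor.uncurry g)
    exact ⟨BalancedTensor.curry ψ, fun m => CharacterDual.ext fun n =>
      hψ (QuotientAddGroup.mk (m ⊗ₜ n))⟩
  · intro h M M' _ _ _ _ f hf
    rw [injective_iff_map_eq_zero]
    intro t ht
    refine CharacterModule.eq_zero_of_character_apply fun χ => ?_
    obtain ⟨g, hg⟩ := h.out f hf (BalancedTensor.curry χ)
    have : (BalancedTensor.uncurry g).comp (BalancedTensor.map N f) = χ :=
      BalancedTensor.hom_ext fun m n => DFunLike.congr_fun (hg m) n
    have h0 := DFunLike.congr_fun this t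
    rw [AddMonoidHom.comp_apply, ht, map_zero] at h0
    exact h0.symm

theorem injective_characterDual_finsupp {R : Type u} [Ring R] {I : Type max u v} :
    Module.Injective Rᵐᵒᵖ (CharacterDual (I →₀ R)) := by
  refine ⟨fun X Y _ _ _ _ f hf g => ?_⟩
  have h (i : I) := CharacterDual.exists_extension f.toAddMonoidHom hf
    (AddMonoidHom.mk' (fun x => g x (Finsupp.single i 1)) fun x y => by
      rw [map_add, CharacterDual.add_apply])
  choose ψ hψ using h
  -- A character of a free module is determined by additive data at each basis vector: extend `x ↦ g
  -- x (e i)` to `ψ i` on `Y`, and let `Ψ y` send `r e i` to `ψ i (y r)`.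
  let Ψ (y : Y) : (I →₀ R) →+ AddCircle (1 : ℚ) := Finsupp.liftAddHom fun i => AddMonoidHom.mk'
    (fun r : R => ψ i (MulOpposite.op r • y)) fun r s => by
      rw [MulOpposite.op_add, add_smul, map_add]
  have hΨ (y : Y) (i : I) (r : R) : Ψ y (Finsupp.single i r) = ψ i (MulOpposite.op r • y) :=
    Finsupp.liftAddHom_apply_single _ _ _
  refine ⟨{ toFun := Ψ, map_add' := fun y y' => ?_, map_smul' := fun r y => ?_ }, fun x => ?_⟩
  · refine Finsupp.addHom_ext fun i s => ?_
    change Ψ (y + y') (Finsupp.single i s) = Ψ y (Finsupp.single i s) + Ψ y' (Finsupp.single i s)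
    rw [hΨ, hΨ, hΨ, smul_add, map_add]
  · refine Finsupp.addHom_ext fun i s => ?_
    change Ψ (r • y) (Finsupp.single i s) = Ψ y (r.unop • Finsupp.single i s)
    rw [Finsupp.smul_single, hΨ, hΨ, smul_smul, smul_eq_mul, MulOpposite.op_mul,
      MulOpposite.op_unop]
  · refine Finsupp.addHom_ext fun i s => ?_
    change Ψ (f x) (Finsupp.single i s) = g x (Finsupp.single i s)
    rw [hΨ, ← map_smul]
    refine (hψ i _).trans ?_
    rw [AddMonoidHom.mk'_apply, map_smul, CharacterDual.smul_apply, MulOpposite.unop_op,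
      Finsupp.smul_single, smul_eq_mul, mul_one]

theorem hasInjectiveDimensionLT_characterDual_iff {R : Type u} [Ring R] {n : ℕ}
    {M F : Type max u v} [AddCommGroup M] [Module R M] [AddCommGroup F] [Module R F]
    (hF : Module.Injective Rᵐᵒᵖ (CharacterDual F)) (f : F →ₗ[R] M) (hf : Function.Surjective f) :
    HasInjectiveDimensionLT (ModuleCat.of Rᵐᵒᵖ (CharacterDual M)) (n + 2) ↔
      HasInjectiveDimensionLT (ModuleCat.of Rᵐᵒᵖ (CharacterDual (LinearMap.ker f))) (n + 1) :=
  hasInjectiveDimensionLT_add_two_iff (CharacterDual.map f)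
    (CharacterDual.map (LinearMap.ker f).subtype) (CharacterDual.map_injective hf)
    (CharacterDual.map_exact_ker hf) (CharacterDual.map_surjective Subtype.val_injective) n

theorem hasInjectiveDimensionLT_of_hasFlatResolution {R : Type u} [Ring R] {n : ℕ}
    {M : Type max u v} [AddCommGroup M] [Module R M] (h : HasFlatResolution R n M) :
    HasInjectiveDimensionLT (ModuleCat.of Rᵐᵒᵖ (CharacterDual M)) (n + 1) := by
  induction h with
  | zero M hM =>
    rw [zero_add, ← injective_iff_hasInjectiveDimensionLT_one,
      ← Module.injective_iff_injective_object]
    exact isFlatModule_iff_injective_characterDual.{u, v}.mp hM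
  | succ n M F hF f hf hker ih =>
    exact (hasInjectiveDimensionLT_characterDual_iff.{u, v}
      (isFlatModule_iff_injective_characterDual.{u, v}.mp hF) f hf).mpr ih

/-- Dualising a flat resolution gives an injective one. Conversely, shift along a free cover, whose
character module is injective. -/
theorem hasFlatResolution_iff {R : Type u} [Ring R] (n : ℕ)
    (M : Type max u v) [AddCommGroup M] [Module R M] :
    HasFlatResolution R n M
      ↔ HasInjectiveDimensionLT (ModuleCat.of Rᵐᵒᵖ (CharacterDual M)) (n + 1) := by
  refine ⟨hasInjectiveDimensionLT_of_hasFlatResolution.{u, v}, fun h => ?_⟩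
  induction n generalizing M with
  | zero =>
    rw [zero_add, ← injective_iff_hasInjectiveDimensionLT_one,
      ← Module.injective_iff_injective_object] at h
    exact .zero M (isFlatModule_iff_injective_characterDual.{u, v}.mpr h)
  | succ n ih =>
    have hinj := injective_characterDual_finsupp.{u, v} (R := R) (I := M)
    let f : (M →₀ R) →ₗ[R] M := Finsupp.linearCombination R id
    have hf : Function.Surjective f := fun m => ⟨Finsupp.single m 1, by simp [f]⟩
    refine .succ n M (M →₀ R) (isFlatModule_iff_injective_characterDual.{u, v}.mpr hinj) f hf
      (ih _ ((hasInjectiveDimensionLT_characterDual_iff.{u, v} hinj f hf).mp h))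

theorem flatDimension_le_of_retract {R : Type u} [Ring R] {M N : Type max u v} [AddCommGroup M]
    [Module R M] [AddCommGroup N] [Module R N] (i : M →ₗ[R] N) (r : N →ₗ[R] M)
    (h : r ∘ₗ i = LinearMap.id) : flatDimension R M ≤ flatDimension R N := by
  refine le_iInf₂ fun n hn => iInf₂_le n ?_
  rw [hasFlatResolution_iff.{u, v}] at hn ⊢
  let ret : Retract (ModuleCat.of Rᵐᵒᵖ (CharacterDual M))
      (ModuleCat.of Rᵐᵒᵖ (CharacterDual N)) :=
    { i := ModuleCat.ofHom (CharacterDual.map r)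
      r := ModuleCat.ofHom (CharacterDual.map i)
      retract := ModuleCat.hom_ext (LinearMap.ext fun χ => CharacterDual.ext fun m =>
        congrArg χ (LinearMap.congr_fun h m)) }
  exact ret.hasInjectiveDimensionLT _

namespace SplitFrobenius

variable {R : Type u} {A : Type (max u v)} [Ring R] [Ring A]
    {φ : R →+* A} {ι : Type*} [Fintype ι] (F : SplitFrobenius φ ι)
include F

theorem flatDimension_restrict (M : Type (max u v)) [AddCommGroup M] [Module A M] [Module R M]
    (hM : ∀ (r : R) (m : M), r • m = φ r • m) : flatDimension R M = flatDimension A M := by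
  have (n : ℕ) : HasFlatResolution R n M ↔ HasFlatResolution A n M := by
    rw [hasFlatResolution_iff.{u, v}, hasFlatResolution_iff.{max u v, max u v},
      F.op.hasInjectiveDimensionLT_restrict_iff]
    exact fun r χ => CharacterDual.ext fun m => congrArg χ (hM r.unop m)
  simp only [flatDimension, this]

theorem weakDim_eq : weakDim.{u, v} R = weakDim.{max u v, v} A := by
  refine le_antisymm (iSup_le fun N => ?_) (iSup_le fun M => ?_)
  · let _ : Module R (Coind φ N) := Module.compHom _ φ
    refine (flatDimension_le_of_retract.{u, v} (F.coindUnit fun _ _ => rfl)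
      (coindEval fun _ _ => rfl) (F.coindEval_comp_coindUnit fun _ _ => rfl)).trans ?_
    rw [F.flatDimension_restrict _ fun _ _ => rfl]
    exact le_iSup (fun M : ModuleCat.{max u v} A => flatDimension A M)
      (ModuleCat.of A (Coind φ N))
  · let _ : Module R M := Module.compHom _ φ
    rw [← F.flatDimension_restrict M fun _ _ => rfl]
    exact le_iSup (fun M : ModuleCat.{max u v} R => flatDimension R M) (ModuleCat.of R M)

end SplitFrobenius

end WeakDimension

/-! ### Semisimple, hereditary, semihereditary and regular rings -/

section RingClasses

/-- If all left ideals (respectively all finitely generated left ideals) are projective, then so are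
all submodules (respectively all finitely generated submodules) of free modules of finite rank. -/
theorem Module.Projective.of_injective_pi {R : Type*} [Ring R] {b : Prop}
    (h : ∀ I : Ideal R, (b → I.FG) → Module.Projective R I) (n : ℕ) (M : Type*) [AddCommGroup M]
    [Module R M] (hM : b → Module.Finite R M) (f : M →ₗ[R] Fin n → R)
    (hf : Function.Injective f) : Module.Projective R M := by
  induction n generalizing M with
  | zero =>
    have : Subsingleton M := hf.subsingleton
    infer_instance
  | succ n ih =>
    -- The image of the first coordinate is a projective ideal, so `M` splits as image plus kernel,
    -- and the kernel embeds in one fewer coordinate.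
    let l : M →ₗ[R] R := LinearMap.proj 0 ∘ₗ f
    have hI : Module.Projective R (LinearMap.range l) :=
      h _ fun hb => by
        have := hM hb
        exact Module.Finite.iff_fg.mp inferInstance
    obtain ⟨s, hs⟩ := Module.projective_lifting_property l.rangeRestrict LinearMap.id
      l.surjective_rangeRestrict
    have hs' (y : LinearMap.range l) : l (s y) = y :=
      congrArg Subtype.val (LinearMap.congr_fun hs y)
    let p : M →ₗ[R] LinearMap.ker l := (LinearMap.id - s ∘ₗ l.rangeRestrict).codRestrict _
      fun m => by simp [hs']
    have hp (m : M) : s (l.rangeRestrict m) + (p m : M) = m := by simp [p]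
    have hker : Module.Projective R (LinearMap.ker l) := by
      refine ih _ (fun hb => ?_)
        (LinearMap.funLeft R R Fin.succ ∘ₗ f ∘ₗ (LinearMap.ker l).subtype) ?_
      · have := hM hb
        refine Module.Finite.of_surjective p fun x => ⟨x, Subtype.ext ?_⟩
        have hx : l.rangeRestrict (x : M) = 0 := Subtype.ext x.2
        simpa [hx] using hp x
      · rw [← LinearMap.ker_eq_bot, LinearMap.ker_eq_bot']
        intro x hx
        refine Subtype.ext (hf ?_)
        ext i
        refine Fin.cases ?_ (fun j => ?_) i
        · have h0 : f (x : M) 0 = 0 := x.2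
          simpa using h0
        · simpa using congrFun hx j
    exact Module.Projective.of_split (l.rangeRestrict.prod p)
      (s.coprod (LinearMap.ker l).subtype) (LinearMap.ext fun m => by simpa using hp m)

section VonNeumannRegular

variable {R : Type*} [Ring R] {M : Type*} [AddCommGroup M] [Module R M]

theorem IsVonNeumannRegular.exists_sum_mul {ι : Type*} (h : IsVonNeumannRegular R) (v : ι → R)
    (s : Finset ι) : ∃ c : ι → R, ∀ i ∈ s, (∑ j ∈ s, v j * c j) * v i = v i := by
  classical
  induction s using Finset.induction_on with
  | empty => exact ⟨0, by simp⟩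
  | insert k s hk ih =>
    obtain ⟨c, hc⟩ := ih
    set g := ∑ j ∈ s, v j * c j with hg
    -- The new left identity is `g + (1 - g) v_k x (1 - g)`: its correction kills the old `v i` and
    -- repairs `v k`.
    obtain ⟨x, hx⟩ := h ((1 - g) * v k)
    refine ⟨fun j => if j = k then x * (1 - g) else c j * (1 - v k * x * (1 - g)), ?_⟩
    have hsum : ∑ j ∈ insert k s, v j *
        (if j = k then x * (1 - g) else c j * (1 - v k * x * (1 - g)))
        = g + (1 - g) * v k * x * (1 - g) := by
      rw [Finset.sum_insert hk, if_pos rfl]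
      have : ∑ j ∈ s, v j * (if j = k then x * (1 - g) else c j * (1 - v k * x * (1 - g)))
          = g * (1 - v k * x * (1 - g)) := by
        rw [hg, Finset.sum_mul]
        refine Finset.sum_congr rfl fun j hj => ?_
        have hjk : j ≠ k := fun e => hk (e ▸ hj)
        rw [if_neg hjk]
        exact (mul_assoc _ _ _).symm
      rw [this]
      noncomm_ring
    intro i hi
    rw [hsum]
    rcases Finset.mem_insert.mp hi with rfl | hi
    · calc _ = g * v i + (1 - g) * v i * x * ((1 - g) * v i) := by noncomm_ring
        _ = _ := by rw [hx]; noncomm_ring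
    · calc _ = g * v i + (1 - g) * v k * x * (v i - g * v i) := by noncomm_ring
        _ = _ := by rw [hc i hi]; simp

theorem IsVonNeumannRegular.exists_smul_eq {ι : Type*} [Fintype ι] (h : IsVonNeumannRegular R)
    (f : M →ₗ[R] ι → R) (hf : Function.Injective f) (v : M) : ∃ l : M →ₗ[R] R, l v • v = v := by
  obtain ⟨c, hc⟩ := h.exists_sum_mul (f v) Finset.univ
  refine ⟨(∑ j, LinearMap.toSpanSingleton R R (c j) ∘ₗ LinearMap.proj j) ∘ₗ f, hf ?_⟩
  ext i
  simpa using hc i (Finset.mem_univ i)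

theorem exists_projection_of_exists_smul_eq (h : ∀ v : M, ∃ l : M →ₗ[R] R, l v • v = v)
    (s : Finset M) : ∃ q : M →ₗ[R] M, (∀ m, q m ∈ Submodule.span R (s : Set M)) ∧
      ∀ m ∈ Submodule.span R (s : Set M), q m = m := by
  classical
  induction s using Finset.induction_on with
  | empty => exact ⟨0, by simp, by simp +contextual⟩
  | insert v s hv ih =>
    obtain ⟨q, hq, hq'⟩ := ih
    obtain ⟨l, hl⟩ := h (v - q v)
    have hle : Submodule.span R (s : Set M) ≤ Submodule.span R ((insert v s : Finset M) : Set M) :=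
      Submodule.span_mono (by simp)
    have hvmem : v ∈ Submodule.span R ((insert v s : Finset M) : Set M) :=
      Submodule.subset_span (by simp)
    -- Correct `q` on the residue `v - q v`, which `l` reproduces; on the old span `m - q m`
    -- vanishes.
    let q' : M →ₗ[R] M := q + (l ∘ₗ (LinearMap.id - q)).smulRight (v - q v)
    have hq'_apply (m : M) : q' m = q m + l (m - q m) • (v - q v) := rfl
    refine ⟨q', fun m => ?_, fun m hm => ?_⟩
    · rw [hq'_apply]
      exact add_mem (hle (hq m)) (Submodule.smul_mem _ _ (sub_mem hvmem (hle (hq v))))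
    · have hmap : Submodule.span R ((insert v s : Finset M) : Set M)
          ≤ LinearMap.eqLocus q' LinearMap.id := by
        rw [Submodule.span_le]
        intro x hx
        rcases Finset.mem_insert.mp hx with rfl | hx
        · change q' x = x
          rw [hq'_apply, hl, add_sub_cancel]
        · change q' x = x
          rw [hq'_apply, hq' x (Submodule.subset_span hx), sub_self, map_zero, zero_smul, add_zero]
      exact hmap hm

end VonNeumannRegular

namespace SplitFrobenius

variable {R A : Type*} [Ring R] [Ring A] {φ : R →+* A} {ι : Type*} [Fintype ι]
  (F : SplitFrobenius φ ι)
include F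

theorem π_mem_of_mem_map (I : Ideal R) {a : A} (ha : a ∈ I.map φ) : F.π a ∈ I := by
  suffices ∀ b : A, F.π (b * a) ∈ I by simpa using this 1
  refine Submodule.span_induction (p := fun a _ => ∀ b : A, F.π (b * a) ∈ I) ?_ ?_ ?_ ?_ ha
  · rintro _ ⟨r, hr, rfl⟩ b
    rw [F.π_mul_right]
    exact I.mul_mem_left _ hr
  · simp
  · intro x y _ _ hx hy b
    rw [mul_add, map_add]
    exact add_mem (hx b) (hy b)
  · intro c x _ hx b
    rw [smul_eq_mul, ← mul_assoc]
    exact hx _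

theorem isSemisimpleRing_iff : IsSemisimpleRing R ↔ IsSemisimpleRing A := by
  constructor
  · intro h
    let _ : Module R A := Module.compHom _ φ
    refine (isSemisimpleModule_iff _ _).mpr ⟨fun I => ?_⟩
    let _ : Module R I := Module.compHom _ φ
    obtain ⟨p, hp⟩ := IsSemisimpleModule.extension_property (R := R)
      ({ I.subtype with map_smul' := fun r x => rfl } : I →ₗ[R] A) Subtype.val_injective
      LinearMap.id
    exact ⟨_, LinearMap.isCompl_of_proj (f := F.average (fun _ _ => rfl) (fun _ _ => rfl) p)
      fun x => F.average_comp (fun _ _ => rfl) (fun _ _ => rfl) p I.subtype LinearMap.id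
        (fun y => LinearMap.congr_fun hp y) x⟩
  · intro h
    refine (isSemisimpleModule_iff _ _).mpr ⟨fun I => ?_⟩
    obtain ⟨p, hp⟩ := IsSemisimpleModule.extension_property (R := A)
      (Submodule.subtype (Ideal.map φ I)) Subtype.val_injective LinearMap.id
    -- A retraction of `A` onto `A I` descends through `φ` and `π`, since `π` maps `A I` into `I`.
    let q : R →ₗ[R] I :=
      { toFun := fun r => ⟨F.π (p (φ r)), F.π_mem_of_mem_map I (p (φ r)).2⟩
        map_add' := fun r s => Subtype.ext (by simp)
        map_smul' := fun r s => Subtype.ext (by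
          rw [smul_eq_mul, map_mul, ← smul_eq_mul, map_smul]
          simp [F.π_mul_left]) }
    refine ⟨_, LinearMap.isCompl_of_proj (f := q) fun x => Subtype.ext ?_⟩
    have := LinearMap.congr_fun hp ⟨φ x, Ideal.mem_map_of_mem φ x.2⟩
    change p (φ x) = _ at this
    change F.π (p (φ x)) = x
    rw [this]
    exact F.π_φ x

/-- Upwards, an ideal of `A` lies in a free `R`-module of finite rank, so it is projective over `R`
and then over `A`. Downwards, `I` is an `R`-summand of `A I` via `φ` and `π`. Taking `b` false or
true gives the hereditary or semihereditary case. -/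
theorem forall_ideal_projective_iff {b : Prop} :
    (∀ I : Ideal R, (b → I.FG) → Module.Projective R I)
      ↔ ∀ I : Ideal A, (b → I.FG) → Module.Projective A I := by
  constructor
  · intro h I hI
    let _ : Module R A := Module.compHom _ φ
    let _ : Module R I := Module.compHom _ φ
    have : IsScalarTower R A I := ⟨fun r a x => mul_smul (φ r) a x⟩
    obtain ⟨i, s, his⟩ := F.exists_retract_self fun _ _ => rfl
    have hinj : Function.Injective i := Function.LeftInverse.injective (g := s) fun a => LinearMap.congr_fun his a
    have : Module.Projective R I := by
      refine Module.Projective.of_injective_pi h (Fintype.card ι) I (fun hb => ?_)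
        ((LinearEquiv.funCongrLeft R R (Fintype.equivFin ι).symm).toLinearMap ∘ₗ i ∘ₗ
          ({ I.subtype with map_smul' := fun r x => rfl } : I →ₗ[R] A)) ?_
      · have : Module.Finite A I := Module.Finite.iff_fg.mpr (hI hb)
        have : Module.Finite R A :=
          Module.Finite.of_surjective s (Function.RightInverse.surjective (f := s) (g := i) fun a => LinearMap.congr_fun his a)
        exact Module.Finite.trans A I
      · exact (LinearEquiv.funCongrLeft R R (Fintype.equivFin ι).symm).injective.comp (hinj.comp Subtype.val_injective)
    exact F.projective_of_projective_restrict fun _ _ => rfl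
  · intro h I hI
    have hJ : Module.Projective A (I.map φ) := h _ fun hb => Ideal.FG.map (hI hb) φ
    let _ : Module R (I.map φ) := Module.compHom _ φ
    have : Module.Projective R (I.map φ) := F.projective_restrict_of_projective fun _ _ => rfl
    exact Module.Projective.of_split (M := I.map φ)
      { toFun := fun r => ⟨φ r, Ideal.mem_map_of_mem φ r.2⟩
        map_add' := fun r s => Subtype.ext (by simp)
        map_smul' := fun r s => Subtype.ext (map_mul φ r s) }
      { toFun := fun a => ⟨F.π a, F.π_mem_of_mem_map I a.2⟩
        map_add' := fun a b => Subtype.ext (by simp)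
        map_smul' := fun r a => Subtype.ext (F.π_mul_left r a) }
      (LinearMap.ext fun r => Subtype.ext (F.π_φ r))

theorem isLeftHereditary_iff : IsLeftHereditary R ↔ IsLeftHereditary A := by
  simpa [IsLeftHereditary] using F.forall_ideal_projective_iff (b := False)

theorem isRightHereditary_iff : IsRightHereditary R ↔ IsRightHereditary A :=
  F.op.isLeftHereditary_iff

theorem isLeftSemihereditary_iff : IsLeftSemihereditary R ↔ IsLeftSemihereditary A := by
  simpa [IsLeftSemihereditary] using F.forall_ideal_projective_iff (b := True)

theorem isRightSemihereditary_iff : IsRightSemihereditary R ↔ IsRightSemihereditary A :=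
  F.op.isLeftSemihereditary_iff

theorem isVonNeumannRegular_iff : IsVonNeumannRegular R ↔ IsVonNeumannRegular A := by
  classical
  constructor
  · intro h a
    let _ : Module R A := Module.compHom _ φ
    obtain ⟨i, s, his⟩ := F.exists_retract_self fun _ _ => rfl
    -- `A a` is spanned over `R` by the `y j * a`, so it is the image of an `R`-linear projection.
    -- Its average `Q` is `A`-linear with `Q a = a` and `Q 1 = b * a`, whence `a * b * a = a`.
    obtain ⟨q, hq, hq'⟩ := exists_projection_of_exists_smul_eq
      (fun v => h.exists_smul_eq i (Function.LeftInverse.injective (g := s) fun a => LinearMap.congr_fun his a) v)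
      (Finset.univ.image fun j => F.y j * a)
    have hmem (c : A) :
        c * a ∈ Submodule.span R ((Finset.univ.image fun j => F.y j * a : Finset A) : Set A) := by
      rw [← F.sum_right c, Finset.sum_mul]
      refine Submodule.sum_mem _ fun j _ => ?_
      rw [mul_assoc]
      exact Submodule.smul_mem _ (F.π (c * F.x j)) (Submodule.subset_span (by simp))
    have hq_mem (c : A) : ∃ d, q c = d * a := by
      refine Submodule.span_induction (p := fun x _ => ∃ d, x = d * a) ?_ ⟨0, by simp⟩ ?_ ?_ (hq c)
      · intro x hx
        obtain ⟨j, -, rfl⟩ := Finset.mem_image.mp hx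
        exact ⟨_, rfl⟩
      · rintro _ _ _ _ ⟨d, rfl⟩ ⟨d', rfl⟩
        exact ⟨d + d', (add_mul _ _ _).symm⟩
      · rintro r _ _ ⟨d, rfl⟩
        exact ⟨φ r * d, (mul_assoc _ _ _).symm⟩
    choose d hd using hq_mem
    let Q : A →ₗ[A] A := F.average (fun _ _ => rfl) (fun _ _ => rfl) q
    have h1 : Q a = a := by
      have := F.average_comp (fun _ _ => rfl) (fun _ _ => rfl) q
        (LinearMap.toSpanSingleton A A a) (LinearMap.toSpanSingleton A A a)
        (fun c => hq' _ (hmem c)) 1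
      simpa using this
    have h2 : Q 1 = (F.w * ∑ j, F.x j * d (F.y j)) * a := by
      change F.w • ∑ j, F.x j • q (F.y j • 1) = _
      simp [hd, Finset.sum_mul, mul_assoc]
    refine ⟨F.w * ∑ j, F.x j * d (F.y j), ?_⟩
    rw [mul_assoc, ← h2, ← smul_eq_mul, ← map_smul, smul_eq_mul, mul_one, h1]
  · intro h a
    obtain ⟨b, hb⟩ := h (φ a)
    refine ⟨F.π b, ?_⟩
    rw [← F.π_mul_left, ← F.π_mul_right, hb, F.π_φ]

end SplitFrobenius

end RingClasses

/-! ### The theorem -/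

theorem corollary2p6 {k : Type w} [Field k] {R : Type u} [Ring R] [Algebra k R] :
    (∀ (H : Type v) [Ring H] [HopfAlgebra k H] [FiniteDimensional k H],
      ((∀ x y : H, x * y = y * x) ∨ Coalgebra.IsCocomm k H) →
      ¬ ringChar k ∣ Module.finrank k H →
      ∀ c : CrossedSystem k R H,
        rightGlobalDim.{u, v} R = rightGlobalDim.{max u v, v} (CrossedProduct c) ∧
        leftGlobalDim.{u, v} R = leftGlobalDim.{max u v, v} (CrossedProduct c) ∧
        weakDim.{u, v} R = weakDim.{max u v, v} (CrossedProduct c) ∧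
        (IsSemisimpleRing R ↔ IsSemisimpleRing (CrossedProduct c)) ∧
        (IsLeftHereditary R ↔ IsLeftHereditary (CrossedProduct c)) ∧
        (IsRightHereditary R ↔ IsRightHereditary (CrossedProduct c)) ∧
        (IsLeftSemihereditary R ↔ IsLeftSemihereditary (CrossedProduct c)) ∧
        (IsRightSemihereditary R ↔ IsRightSemihereditary (CrossedProduct c)) ∧
        (IsVonNeumannRegular R ↔ IsVonNeumannRegular (CrossedProduct c))) ∧
    (∀ (G : Type v) [Group G] [Finite G] [MulSemiringAction G R],
      (Nat.card G : k) ≠ 0 →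
      rightGlobalDim.{u, v} R = rightGlobalDim.{max u v, v} (SkewMonoidAlgebra R G)) := by
  refine ⟨fun H _ _ _ hH hchar c => ?_, fun G _ _ _ hG => ?_⟩
  · obtain ⟨φ, n, _, ⟨F⟩⟩ := CrossedProduct.exists_splitFrobenius hH
      (fun h0 => hchar ((ringChar.spec k _).mp h0)) c
    exact ⟨F.rightGlobalDim_eq, F.leftGlobalDim_eq, F.weakDim_eq, F.isSemisimpleRing_iff,
      F.isLeftHereditary_iff, F.isRightHereditary_iff, F.isLeftSemihereditary_iff,
      F.isRightSemihereditary_iff, F.isVonNeumannRegular_iff⟩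
  · have hu : IsUnit (Nat.card G : R) := by
      simpa using (IsUnit.mk0 _ hG).map (algebraMap k R)
    obtain ⟨φ, n, _, ⟨F⟩⟩ := SkewMonoidAlgebra.exists_splitFrobenius (R := R) hu
    exact F.rightGlobalDim_eq
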